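/- Write $e(x)=e^{2\pi i x}$. Let $k\ge 3$ be an integer and set $$\theta_\infty(x)=\frac{i}{2\pi}\Bigl\{\bigl(x+\sqrt{x^2-1}\bigr)^{k-1}-\bigl(x-\sqrt{x^2-1}\bigr)^{k-1}\Bigr\}\quad(|x|<1),\qquad \theta_\infty(x)=0\quad(|x|\ge 1),$$ where $\sqrt{x^2-1}=i\sqrt{1-x^2}$ for $|x|<1$. For $x,y>0$ let $$F(x)=\frac{1}{2K_0(2)}\int_x^\infty e^{-t-1/t}\,\frac{dt}{t},\qquad H(y)=\frac{\sqrt{\pi}}{2\pi i}\int_{\Re u=1}\frac{\Gamma\left(\frac{1+u}{2}\right)}{\Gamma\left(\frac{2-u}{2}\right)}(\pi y)^{-u}\tilde F(u)\,du,$$ where $K_0$ is the modified Bessel function and $\tilde F(u)=\int_0^\infty F(x)x^{u-1}dx$. For positive integers $l,f,n$ and $\xi\in\mathbb Z$ let $$I_{l,f}(\xi,n)=\int_{-1}^{1}\theta_\infty(x)\left\{F\left(\frac{lf^2(4n)^{-1/2}}{\sqrt{1-x^2}}\right)+\frac{lf^2(4n)^{-1/2}}{\sqrt{1-x^2}}\,H\left(\frac{lf^2(4n)^{-1/2}}{\sqrt{1-x^2}}\right)\right\}e\left(\frac{-x\xi\sqrt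 n}{2lf^2}\right)dx,$$ $$Kl_{l,f}(\xi,n)=\sum_{\substack{a \bmod 4lf^2\\ f^2\mid a^2-4n\\ (a^2-4n)/f^2\equiv 0,1 \bmod 4}}\left(\frac{(a^2-4n)/f^2}{l}\right)e\left(\frac{a\xi}{4lf^2}\right),$$ with the Kronecker symbol. Fix constants $c_1,c_2,c_3,c_4>0$ and, for real $\kappa,\alpha>0$ and $X>0$, let $$S(X,\kappa,\alpha)=\sum_{1\le n<X}\sqrt n\sum_{\substack{l,f\ge 1\\ c_1X^{\frac14-\kappa}\le lf^2\le c_2X^{\frac12+\kappa}}}\frac{1}{l^2f^3}\sum_{\substack{\xi\in\mathbb Z\setminus\{0\}\\ lf^2|\xi|\le c_3X^{\frac12+\kappa}\\ |\xi|\le c_4X^{\frac16+\kappa+\alpha}}}Kl_{l,f}(\xi,n)\,I_{l,f}(\xi,n).$$ Theorem. Let $\kappa,\alpha>0$ satisfy $2\kappa+\alpha<\frac1{12}$. Then for every $\epsilon>0$ there is a constant $K$, depending only on $k,\kappa,\alpha,\epsilon$ and on the constants $c_1,c_2,c_3,c_4$ fixed in the ranges of summation, such that for all $X>0$ $$|S(X,\kappa,\alpha)|\le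 K\,X^{\frac{11}{12}+\kappa+\alpha+\frac{11\epsilon}{6}}.$$ -/

import Mathlib

namespace BeyondEndoscopy

open scoped Real

noncomputable section

/-- The additive character `e(x) = exp(2 π i x)`. -/
def e (x : ℝ) : ℂ := Complex.exp (2 * π * Complex.I * x)

/-- The Kronecker symbol `(D / l)` for an integer `D` and a positive integer `l`: the symbol
`(D / 2)` is `0` for even `D`, `1` for `D ≡ ± 1 mod 8` and `-1` for `D ≡ ± 3 mod 8`, and the
odd part of `l` is treated with the Jacobi symbol. -/
def kronecker (D : ℤ) (l : ℕ) : ℤ :=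
  ZMod.χ₈ (D : ZMod 8) ^ padicValNat 2 l * jacobiSym D (l / 2 ^ padicValNat 2 l)

/-- The character sum `Kl_{l,f}(ξ, n)`: the sum of `((a ^ 2 - 4 n) / f ^ 2 / l) e(a ξ / (4 l f ^ 2))`
over the `a` modulo `4 l f ^ 2` such that `f ^ 2 ∣ a ^ 2 - 4 n` and
`(a ^ 2 - 4 n) / f ^ 2 ≡ 0, 1 mod 4`. -/
def Kl (l f : ℕ) (ξ : ℤ) (n : ℕ) : ℂ :=
  ∑ a ∈ (Finset.range (4 * l * f ^ 2)).filter (fun a : ℕ =>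
      (f : ℤ) ^ 2 ∣ (a : ℤ) ^ 2 - 4 * n ∧
        (((a : ℤ) ^ 2 - 4 * n) / (f : ℤ) ^ 2 ≡ 0 [ZMOD 4] ∨
          ((a : ℤ) ^ 2 - 4 * n) / (f : ℤ) ^ 2 ≡ 1 [ZMOD 4])),
    (kronecker (((a : ℤ) ^ 2 - 4 * n) / (f : ℤ) ^ 2) l : ℂ) *
      e ((a : ℝ) * ξ / (4 * l * f ^ 2))

/-- The archimedean function attached to the weight `k`:
`(i / 2π) ((x + √(x² - 1)) ^ (k - 1) - (x - √(x² - 1)) ^ (k - 1))` for `|x| < 1`,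
where `√(x² - 1) = i √(1 - x²)`, and `0` for `|x| ≥ 1`. -/
def thetaInf (k : ℕ) (x : ℝ) : ℂ :=
  if |x| < 1 then
    Complex.I / (2 * π) *
      (((x : ℂ) + Complex.I * (√(1 - x ^ 2) : ℝ)) ^ (k - 1) -
        ((x : ℂ) - Complex.I * (√(1 - x ^ 2) : ℝ)) ^ (k - 1))
  else 0

/-- The modified Bessel function `K₀(z) = ∫_0^∞ exp(-z cosh t) dt`, for `z > 0`. -/
def besselK0 (z : ℝ) : ℝ := ∫ t in Set.Ioi (0 : ℝ), Real.exp (-z * Real.cosh t)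

/-- The cut-off function `F(x) = (1 / (2 K₀(2))) ∫_x^∞ exp(-y - 1/y) dy / y`, for `x > 0`. -/
def F (x : ℝ) : ℝ :=
  1 / (2 * besselK0 2) * ∫ y in Set.Ioi x, Real.exp (-y - 1 / y) / y

/-- The function
`H(y) = (√π / (2 π i)) ∫_{Re u = 1} Γ((1 + u) / 2) / Γ((2 - u) / 2) (π y)^{-u} F~(u) du`,
for `y > 0`, where `F~` is the Mellin transform of `F`. Mathlib's `mellinInv 1 g x` is
`(1 / (2 π i)) ∫_{Re u = 1} x^{-u} g(u) du`. -/
def H (y : ℝ) : ℂ :=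
  (√π : ℝ) * mellinInv 1 (fun u : ℂ =>
    Complex.Gamma ((1 + u) / 2) / Complex.Gamma ((2 - u) / 2) *
      mellin (fun x : ℝ => (F x : ℂ)) u) (π * y)

/-- The Fourier transform `I_{l,f}(ξ, n)` in weight `k`. -/
def I (k l f : ℕ) (ξ : ℤ) (n : ℕ) : ℂ :=
  ∫ x in (-1 : ℝ)..1,
    thetaInf k x *
      ((F ((l : ℝ) * f ^ 2 / √(4 * n) / √(1 - x ^ 2)) : ℂ) +
        ((l : ℝ) * f ^ 2 / √(4 * n) / √(1 - x ^ 2) : ℝ) *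
          H ((l : ℝ) * f ^ 2 / √(4 * n) / √(1 - x ^ 2))) *
      e (-x * ξ * √n / (2 * l * f ^ 2))

/-- The pairs `(l, f)` of positive integers with `c₁ X^(1/4 - κ) ≤ l f² ≤ c₂ X^(1/2 + κ)`. -/
def critPairs (c₁ c₂ X κ : ℝ) : Finset (ℕ × ℕ) :=
  (Finset.Icc 1 ⌊c₂ * X ^ (1 / 2 + κ)⌋₊ ×ˢ Finset.Icc 1 ⌊c₂ * X ^ (1 / 2 + κ)⌋₊).filter
    (fun p => c₁ * X ^ (1 / 4 - κ) ≤ (p.1 : ℝ) * p.2 ^ 2 ∧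
      (p.1 : ℝ) * p.2 ^ 2 ≤ c₂ * X ^ (1 / 2 + κ))

/-- The nonzero integers `ξ` with `l f² |ξ| ≤ c₃ X^(1/2 + κ)` and `|ξ| ≤ c₄ X^(1/6 + κ + α)`. -/
def critFreqs (c₃ c₄ X κ α : ℝ) (l f : ℕ) : Finset ℤ :=
  (Finset.Icc (-⌊c₄ * X ^ (1 / 6 + κ + α)⌋) ⌊c₄ * X ^ (1 / 6 + κ + α)⌋).filter
    (fun ξ => ξ ≠ 0 ∧ (l : ℝ) * f ^ 2 * |(ξ : ℝ)| ≤ c₃ * X ^ (1 / 2 + κ) ∧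
      |(ξ : ℝ)| ≤ c₄ * X ^ (1 / 6 + κ + α))

/-- The box in the definition of `critPairs` imposes nothing but positivity. -/
theorem mem_critPairs {c₁ c₂ X κ : ℝ} {l f : ℕ} :
    (l, f) ∈ critPairs c₁ c₂ X κ ↔ 1 ≤ l ∧ 1 ≤ f ∧
      c₁ * X ^ (1 / 4 - κ) ≤ (l : ℝ) * f ^ 2 ∧ (l : ℝ) * f ^ 2 ≤ c₂ * X ^ (1 / 2 + κ) := by
  simp only [critPairs, Finset.mem_filter, Finset.mem_product, Finset.mem_Icc]
  refine ⟨fun h => ⟨h.1.1.1, h.1.2.1, h.2.1, h.2.2⟩, fun ⟨hl, hf, h1, h2⟩ => ?_⟩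
  have hl' : (1 : ℝ) ≤ l := by exact_mod_cast hl
  have hf' : (1 : ℝ) ≤ f := by exact_mod_cast hf
  refine ⟨⟨⟨hl, Nat.le_floor (le_trans ?_ h2)⟩, ⟨hf, Nat.le_floor (le_trans ?_ h2)⟩⟩, h1, h2⟩
  · nlinarith [mul_nonneg (sub_nonneg.2 hf') (sub_nonneg.2 hf')]
  · nlinarith [mul_nonneg (sub_nonneg.2 hl') (sq_nonneg (f : ℝ))]

/-- The interval in the definition of `critFreqs` imposes nothing extra. -/
theorem mem_critFreqs {c₃ c₄ X κ α : ℝ} {l f : ℕ} {ξ : ℤ} :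
    ξ ∈ critFreqs c₃ c₄ X κ α l f ↔ ξ ≠ 0 ∧
      (l : ℝ) * f ^ 2 * |(ξ : ℝ)| ≤ c₃ * X ^ (1 / 2 + κ) ∧
      |(ξ : ℝ)| ≤ c₄ * X ^ (1 / 6 + κ + α) := by
  simp only [critFreqs, Finset.mem_filter, Finset.mem_Icc]
  refine ⟨fun h => h.2, fun h => ⟨abs_le.1 (Int.le_floor.2 ?_), h⟩⟩
  push_cast
  exact h.2.2

/-- The critical-range sum `S(X, κ, α)` in weight `k`; the sum over `n` runs over the positive
integers `n < X`, and `c₁, c₂, c₃, c₄` are the constants implied in the ranges of summation. -/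
def S (k : ℕ) (c₁ c₂ c₃ c₄ X κ α : ℝ) : ℂ :=
  ∑ n ∈ Finset.Ico 1 ⌈X⌉₊, (√(n : ℝ) : ℂ) *
    ∑ p ∈ critPairs c₁ c₂ X κ, 1 / ((p.1 : ℂ) ^ 2 * (p.2 : ℂ) ^ 3) *
      ∑ ξ ∈ critFreqs c₃ c₄ X κ α p.1 p.2, Kl p.1 p.2 ξ n * I k p.1 p.2 ξ n

end

end BeyondEndoscopy

/-! ### Fourier analysis and quadratic Gauss sums on `ZMod q`. -/

namespace BeyondEndoscopy

open scoped Real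
open Finset

/-! The sum over `n` is carried out first, for fixed `l`, `f`, `ξ`. Put `q = 4 l f ^ 2`. Then `Kl`
depends only on `4 n` modulo `q`, and the heart of the proof is a bound for its partial sums over
`n` that does not grow with their length. As a function of `t = 4 n`, `Kl` is a correlation along
the squares `a ^ 2`, twisted by `e(a ξ / q)`. Parseval and a Gauss sum bound uniform in the
quadratic coefficient give its mean square (`sum_norm_sq_klMod_le`), and Cauchy–Schwarz then handles
any block of at most `l f ^ 2` consecutive `n`. Sums over a full period vanish unless `q ∣ 2 ξ`
(`sum_period_klMod_eq_zero`). Since `2 κ + α < 1 / 12`, the frequencies are of smaller order than `l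
f ^ 2`, so this exception occurs only for bounded `X` (`exists_forall_dvd_le`).

The weight `√n I(n)` is removed by partial summation, which needs `I` bounded with increments `O(1 /
n)`, uniformly in `l`, `f`, `ξ` (`exists_I_bounds`). Differentiating the phase would lose a factor
`ξ √n / (l f ^ 2)`. Instead `x` is dilated together with `c = l f ^ 2 / √(4 n)`, which leaves the
phase `x / c` fixed, so that only the amplitude varies. That variation is controlled because `F(y) +
y H(y)` is bounded and Lipschitz in `log y` (`exists_W_bounds`), a consequence of the rapid decay of
`K_s(2)` on vertical lines.

What remains is `√X` times the sum of `√(gcd(ξ, l) / l)` over `l`, `f`, `ξ`. Writing `√l f |ξ| = √(l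
f ^ 2 |ξ|) √|ξ|` and inserting the two bounds on `ξ` gives `X ^ (5/6 + κ + α/2)` times four harmonic
sums, which fits inside the claimed power. -/

/-- Parseval's identity on `ZMod q`. -/
theorem sum_norm_sq_addChar_sum {q : ℕ} [NeZero q] (c : ZMod q → ℂ) :
    ∑ t : ZMod q, ‖∑ h : ZMod q, c h * ZMod.stdAddChar (h * t)‖ ^ 2 = q * ∑ h, ‖c h‖ ^ 2 := by
  have key : ∑ t : ZMod q, ((‖∑ h : ZMod q, c h * ZMod.stdAddChar (h * t)‖ ^ 2 : ℝ) : ℂ) =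
      q * ∑ h, ((‖c h‖ ^ 2 : ℝ) : ℂ) := by
    have h1 : ∀ t : ZMod q, ((‖∑ h : ZMod q, c h * ZMod.stdAddChar (h * t)‖ ^ 2 : ℝ) : ℂ) =
        ∑ h, ∑ h', c h * (starRingEnd ℂ) (c h') * ZMod.stdAddChar (t * (h - h')) := by
      intro t
      push_cast
      rw [← Complex.mul_conj', map_sum, sum_mul_sum]
      refine sum_congr rfl fun h _ => sum_congr rfl fun h' _ => ?_
      rw [map_mul (starRingEnd ℂ), mul_sub, sub_eq_add_neg, AddChar.map_add_eq_mul, ← AddChar.map_neg_eq_conj,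
        mul_comm h t, mul_comm h' t]
      ring
    simp_rw [h1]
    rw [sum_comm, mul_sum]
    refine sum_congr rfl fun h _ => ?_
    rw [sum_comm]
    simp_rw [← mul_sum, AddChar.sum_mulShift _ (ZMod.isPrimitive_stdAddChar q), sub_eq_zero]
    simp only [ZMod.card, Nat.cast_ite, Nat.cast_zero, mul_ite, mul_zero, sum_ite_eq, mem_univ,
      if_true]
    rw [Complex.mul_conj']
    push_cast
    ring
  exact_mod_cast key

/-- A mean-square bound for correlations of a weighted family of translates, in terms of the
exponential sums of the family. -/
theorem sum_norm_sq_correlation_le {q : ℕ} [NeZero q] (u B : ZMod q → ℂ) (s : ZMod q → ZMod q)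
    {R : ℝ} (hR : ∀ h : ZMod q, ‖∑ a, u a * ZMod.stdAddChar (h * s a)‖ ^ 2 ≤ R) :
    ∑ t : ZMod q, ‖∑ a, u a * B (s a - t)‖ ^ 2 ≤ R * ∑ m, ‖B m‖ ^ 2 := by
  have hq : (q : ℝ) ≠ 0 := Nat.cast_ne_zero.2 (NeZero.ne q)
  have hqC : (q : ℂ) ≠ 0 := Nat.cast_ne_zero.2 (NeZero.ne q)
  set D : ZMod q → ℂ := fun h => ∑ m, B m * ZMod.stdAddChar (m * h) with hD
  have hB : ∀ m, B m = (q : ℂ)⁻¹ * ∑ h, D h * ZMod.stdAddChar (-(h * m)) := by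
    intro m
    have : ∑ h, D h * ZMod.stdAddChar (-(h * m)) = q * B m := by
      simp_rw [hD, sum_mul]
      rw [sum_comm]
      have : ∀ m' : ZMod q, ∑ h : ZMod q,
          B m' * ZMod.stdAddChar (m' * h) * ZMod.stdAddChar (-(h * m)) =
          if m' = m then q * B m else 0 := by
        intro m'
        have h2 : ∀ h : ZMod q, B m' * ZMod.stdAddChar (m' * h) * ZMod.stdAddChar (-(h * m)) =
            B m' * ZMod.stdAddChar (h * (m' - m)) := by
          intro h
          rw [mul_assoc, ← AddChar.map_add_eq_mul]
          ring_nf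
        simp_rw [h2, ← mul_sum, AddChar.sum_mulShift _ (ZMod.isPrimitive_stdAddChar q), sub_eq_zero]
        split_ifs with h3
        · rw [h3, ZMod.card, mul_comm]
        · simp
      simp_rw [this]
      simp
    rw [this]
    field_simp
  have hP : ∑ h, ‖D h‖ ^ 2 = q * ∑ m, ‖B m‖ ^ 2 := sum_norm_sq_addChar_sum B
  have hC : ∀ t, ∑ a, u a * B (s a - t) =
      ∑ h, ((q : ℂ)⁻¹ * D h * ∑ a, u a * ZMod.stdAddChar (-h * s a)) *
        ZMod.stdAddChar (h * t) := by
    intro t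
    simp_rw [hB, mul_sum, sum_mul]
    rw [sum_comm]
    refine sum_congr rfl fun h _ => sum_congr rfl fun a _ => ?_
    have : ZMod.stdAddChar (-(h * (s a - t))) =
        ZMod.stdAddChar (-h * s a) * ZMod.stdAddChar (h * t) := by
      rw [← AddChar.map_add_eq_mul]
      ring_nf
    rw [this]
    ring
  simp_rw [hC]
  rw [sum_norm_sq_addChar_sum]
  calc (q : ℝ) * ∑ h, ‖(q : ℂ)⁻¹ * D h * ∑ a, u a * ZMod.stdAddChar (-h * s a)‖ ^ 2
      ≤ q * ∑ h, (q : ℝ)⁻¹ ^ 2 * (‖D h‖ ^ 2 * R) := by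
        gcongr with h
        rw [norm_mul, norm_mul, mul_pow, mul_pow, norm_inv, Complex.norm_natCast, mul_assoc]
        gcongr
        exact hR (-h)
    _ = R * ∑ m, ‖B m‖ ^ 2 := by
        rw [← mul_sum, ← sum_mul, hP]
        field_simp

/-- By Bézout every solution is killed by the gcd, and a cyclic group has at most `g` elements
killed by `g`. -/
theorem card_mul_eq_zero_le {q : ℕ} [NeZero q] (ξ : ℤ) :
    #{s : ZMod q | (ξ : ZMod q) * s = 0} ≤ Int.gcd ξ q := by
  have hg : 0 < Int.gcd ξ q := Int.gcd_pos_of_ne_zero_right _ (Nat.cast_ne_zero.2 (NeZero.ne q))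
  refine le_trans (card_le_card ?_) (IsAddCyclic.card_nsmul_eq_zero_le (α := ZMod q) hg)
  intro s hs
  simp only [mem_filter, mem_univ, true_and] at hs ⊢
  have h := congrArg (fun z : ℤ => (z : ZMod q)) (Int.gcd_eq_gcd_ab ξ q)
  simp only [Int.cast_natCast, Int.cast_add, Int.cast_mul, CharP.cast_eq_zero, zero_mul,
    add_zero] at h
  rw [nsmul_eq_mul, h, mul_right_comm, hs, zero_mul]

/-- The quadratic Gauss sum with a linear term. -/
theorem norm_sq_gaussSum_le {q : ℕ} [NeZero q] (ξ : ℤ) (h : ZMod q) :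
    ‖∑ a : ZMod q, ZMod.stdAddChar ((ξ : ZMod q) * a) * ZMod.stdAddChar (h * a ^ 2)‖ ^ 2 ≤
      (q : ℝ) * Int.gcd (2 * ξ) q := by
  classical
  set ψ : AddChar (ZMod q) ℂ := ZMod.stdAddChar with hψ
  set T : Finset (ZMod q) := {s | 2 * h * s = 0} with hT
  set φ : ZMod q → ℂ := fun s => ψ (ξ * s + h * s ^ 2) with hφ
  have hsq : ((‖∑ a : ZMod q, ψ ((ξ : ZMod q) * a) * ψ (h * a ^ 2)‖ ^ 2 : ℝ) : ℂ) =
      q * ∑ s ∈ T, φ s := by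
    push_cast
    rw [← Complex.mul_conj', map_sum, sum_mul_sum]
    have h1 : ∀ b : ZMod q, ∑ a, ψ ((ξ : ZMod q) * a) * ψ (h * a ^ 2) *
        (starRingEnd ℂ) (ψ ((ξ : ZMod q) * b) * ψ (h * b ^ 2)) =
        ∑ s, φ s * ψ (b * (2 * h * s)) := by
      intro b
      -- Weyl differencing: with `a = s + b` the square of `b` cancels, so the sum over `b` is
      -- linear and detects `2 h s = 0`.
      rw [← Equiv.sum_comp (Equiv.addRight b)]
      refine sum_congr rfl fun s _ => ?_
      rw [map_mul (starRingEnd ℂ), ← AddChar.map_neg_eq_conj, ← AddChar.map_neg_eq_conj,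
        ← AddChar.map_add_eq_mul, ← AddChar.map_add_eq_mul, ← AddChar.map_add_eq_mul, hφ,
        ← AddChar.map_add_eq_mul]
      simp only [Equiv.coe_addRight]
      ring_nf
    rw [sum_comm]
    simp_rw [h1]
    rw [sum_comm]
    simp_rw [← mul_sum, hψ, AddChar.sum_mulShift _ (ZMod.isPrimitive_stdAddChar q)]
    rw [hT, sum_filter, mul_sum]
    refine sum_congr rfl fun s _ => ?_
    split_ifs <;> simp [mul_comm]
  -- The cross term `2 h s t` vanishes, so `φ` is a character of the subgroup `T`: its sum over `T`
  -- is `0` or `#T`.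
  have hadd : ∀ s ∈ T, ∀ t, φ (s + t) = φ s * φ t := by
    intro s hs t
    simp only [hT, mem_filter, mem_univ, true_and] at hs
    simp only [hφ]
    rw [← AddChar.map_add_eq_mul]
    congr 1
    linear_combination t * hs
  have hnorm : ∀ s, ‖φ s‖ = 1 := fun s => AddChar.norm_apply _ _
  have hsum : ‖∑ s ∈ T, φ s‖ ≤ Int.gcd (2 * ξ) q := by
    by_cases htriv : ∀ s ∈ T, φ s = 1
    · have hsub : T ⊆ ({s : ZMod q | ((2 * ξ : ℤ) : ZMod q) * s = 0} : Finset _) := by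
        intro s hs
        have hs' := hs
        simp only [hT, mem_filter, mem_univ, true_and] at hs ⊢
        -- Triviality is tested at `2 s`, because `4 h s ^ 2` vanishes on `T` while `h s ^ 2` need
        -- not. This leaves `2 ξ s = 0`, a condition free of `h`.
        have h2s : s + s ∈ T := by
          simp only [hT, mem_filter, mem_univ, true_and]
          rw [mul_add, hs, add_zero]
        have h3 := htriv _ h2s
        simp only [hφ] at h3
        rw [← AddChar.map_zero_eq_one ψ] at h3
        have h4 := ZMod.injective_stdAddChar h3
        push_cast
        linear_combination h4 - 2 * s * hs
      calc ‖∑ s ∈ T, φ s‖ ≤ ∑ s ∈ T, ‖φ s‖ := norm_sum_le _ _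
        _ = (#T : ℝ) := by simp [hnorm]
        _ ≤ Int.gcd (2 * ξ) q := by
          exact_mod_cast (card_le_card hsub).trans (card_mul_eq_zero_le (2 * ξ))
    · push Not at htriv
      obtain ⟨s₀, hs₀, hne⟩ := htriv
      have hshift : ∑ s ∈ T, φ s = φ s₀ * ∑ s ∈ T, φ s := by
        rw [mul_sum]
        refine sum_nbij' (fun s => s - s₀) (fun s => s₀ + s) ?_ ?_ ?_ ?_ ?_
        · intro s hs
          simp only [hT, mem_filter, mem_univ, true_and] at hs hs₀ ⊢
          rw [mul_sub, hs, hs₀, sub_zero]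
        · intro s hs
          simp only [hT, mem_filter, mem_univ, true_and] at hs hs₀ ⊢
          rw [mul_add, hs, hs₀, add_zero]
        · intro s _; simp
        · intro s _; simp
        · intro s _
          rw [← hadd s₀ hs₀]; simp
      have h0 : (φ s₀ - 1) * ∑ s ∈ T, φ s = 0 := by
        rw [sub_mul, ← hshift]; ring
      rcases mul_eq_zero.1 h0 with h0 | h0
      · exact absurd (sub_eq_zero.1 h0) hne
      · rw [h0, norm_zero]; positivity
  have hfin : ‖∑ a : ZMod q, ψ ((ξ : ZMod q) * a) * ψ (h * a ^ 2)‖ ^ 2 =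
      q * ‖∑ s ∈ T, φ s‖ := by
    have := congrArg norm hsq
    rwa [norm_mul, Complex.norm_natCast, Complex.norm_real, Real.norm_of_nonneg (by positivity)]
      at this
  rw [hfin]
  gcongr

end BeyondEndoscopy

/-! ### Partial sums over `n` of the character sums `Kl`. -/

namespace BeyondEndoscopy

open scoped Real
open Finset

/-- The summand of `Kl` without its additive character, as a function of `M = a ^ 2 - 4 n`. -/
noncomputable def discWeight (l f : ℕ) (M : ℤ) : ℂ :=
  if (f : ℤ) ^ 2 ∣ M ∧ (M / (f : ℤ) ^ 2 ≡ 0 [ZMOD 4] ∨ M / (f : ℤ) ^ 2 ≡ 1 [ZMOD 4]) then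
    (kronecker (M / (f : ℤ) ^ 2) l : ℂ) else 0

theorem norm_kronecker_le_one (D : ℤ) (l : ℕ) : ‖(kronecker D l : ℂ)‖ ≤ 1 := by
  have h1 : ‖((ZMod.χ₈ (D : ZMod 8) : ℤ) : ℂ)‖ ≤ 1 := by
    rcases ZMod.isQuadratic_χ₈ (D : ZMod 8) with h | h | h <;> simp [h]
  have h2 : ‖((jacobiSym D (l / 2 ^ padicValNat 2 l) : ℤ) : ℂ)‖ ≤ 1 := by
    rcases jacobiSym.trichotomy D (l / 2 ^ padicValNat 2 l) with h | h | h <;> simp [h]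
  rw [kronecker]
  push_cast
  rw [norm_mul, norm_pow]
  exact mul_le_one₀ (pow_le_one₀ (norm_nonneg _) h1) (norm_nonneg _) h2

/-- The Jacobi factor has period dividing `l`. The factor at `2` has period `8`, which divides `4 l`
for even `l`, and it is absent for odd `l`. -/
theorem kronecker_add_mul (D j : ℤ) {l : ℕ} : kronecker (D + 4 * l * j) l = kronecker D l := by
  have hjac : jacobiSym (D + 4 * l * j) (l / 2 ^ padicValNat 2 l) =
      jacobiSym D (l / 2 ^ padicValNat 2 l) := by
    have hdvd : (l / 2 ^ padicValNat 2 l) ∣ l := Nat.div_dvd_of_dvd pow_padicValNat_dvd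
    rw [jacobiSym.mod_left, jacobiSym.mod_left D]
    congr 1
    apply Int.emod_emod_of_dvd _ (dvd_refl _) |>.symm.trans
    obtain ⟨c, hc⟩ := hdvd
    have : (4 * l * j : ℤ) = ((l / 2 ^ padicValNat 2 l : ℕ) : ℤ) * (4 * c * j) := by
      conv_lhs => rw [hc]
      push_cast
      ring
    rw [this, Int.add_mul_emod_self_left, Int.emod_emod_of_dvd _ (dvd_refl _)]
  rw [kronecker, kronecker, hjac]
  by_cases h2 : 2 ∣ l
  · obtain ⟨c, hc⟩ := h2
    have : ((D + 4 * l * j : ℤ) : ZMod 8) = (D : ZMod 8) := by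
      rw [ZMod.intCast_eq_intCast_iff]
      refine Int.emod_emod_of_dvd _ (dvd_refl _) |>.symm.trans ?_
      have : (4 * l * j : ℤ) = 8 * (c * j) := by rw [hc]; push_cast; ring
      rw [this]
      simp
    rw [this]
  · rw [padicValNat.eq_zero_of_not_dvd h2, pow_zero, pow_zero, pow_zero]

theorem norm_discWeight_le_one (l f : ℕ) (M : ℤ) : ‖discWeight l f M‖ ≤ 1 := by
  rw [discWeight]
  split_ifs
  · exact norm_kronecker_le_one _ _
  · simp

theorem discWeight_add_mul {l f : ℕ} (hf : 0 < f) (M j : ℤ) :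
    discWeight l f (M + (4 * l * f ^ 2 : ℕ) * j) = discWeight l f M := by
  have hf' : (f : ℤ) ^ 2 ≠ 0 := by positivity
  have h1 : M + (4 * l * f ^ 2 : ℕ) * j = M + (f : ℤ) ^ 2 * (4 * l * j) := by push_cast; ring
  have hdiv : (M + (f : ℤ) ^ 2 * (4 * l * j)) / (f : ℤ) ^ 2 = M / (f : ℤ) ^ 2 + 4 * l * j :=
    Int.add_mul_ediv_left _ _ hf'
  have hmod : ∀ r : ℤ, (M / (f : ℤ) ^ 2 + 4 * l * j ≡ r [ZMOD 4]) ↔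
      (M / (f : ℤ) ^ 2 ≡ r [ZMOD 4]) := by
    intro r
    rw [Int.ModEq, Int.ModEq, mul_assoc, Int.add_mul_emod_self_left]
  rw [discWeight, discWeight, h1, hdiv, kronecker_add_mul]
  simp only [hmod, Int.dvd_add_left (Dvd.intro _ rfl)]

/-- `discWeight` on residues modulo `4 l f ^ 2`. -/
noncomputable def discWeightMod (l f : ℕ) (m : ZMod (4 * l * f ^ 2)) : ℂ :=
  discWeight l f (m.val : ℤ)

theorem discWeightMod_intCast {l f : ℕ} [NeZero (4 * l * f ^ 2)] (hf : 0 < f) (M : ℤ) :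
    discWeightMod l f (M : ZMod (4 * l * f ^ 2)) = discWeight l f M := by
  rw [discWeightMod, ZMod.val_intCast]
  conv_rhs => rw [← Int.emod_add_mul_ediv M ((4 * l * f ^ 2 : ℕ) : ℤ)]
  rw [discWeight_add_mul hf]

/-- The support lies in the multiples of `f ^ 2`, which form `4 l` of the `4 l f ^ 2` classes. This
saves `f ^ 2` over the trivial bound. -/
theorem sum_norm_sq_discWeightMod_le {l f : ℕ} [NeZero (4 * l * f ^ 2)] :
    ∑ m : ZMod (4 * l * f ^ 2), ‖discWeightMod l f m‖ ^ 2 ≤ 4 * l := by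
  classical
  have hcard : #{m : ZMod (4 * l * f ^ 2) | f ^ 2 ∣ m.val} ≤ 4 * l := by
    have : #{m : ZMod (4 * l * f ^ 2) | f ^ 2 ∣ m.val} ≤ #(range (4 * l)) := by
      refine card_le_card_of_injOn (fun m => m.val / f ^ 2) ?_ ?_
      · intro m _
        simp only [coe_range, Set.mem_Iio]
        exact Nat.div_lt_of_lt_mul ((ZMod.val_lt m).trans_eq (mul_comm _ _))
      · intro m hm m' hm' h
        simp only [coe_filter, mem_univ, true_and, Set.mem_ofPred_eq] at hm hm'
        apply ZMod.val_injective
        rw [← Nat.div_mul_cancel hm, ← Nat.div_mul_cancel hm']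
        exact congrArg (· * f ^ 2) h
    simpa using this
  calc ∑ m : ZMod (4 * l * f ^ 2), ‖discWeightMod l f m‖ ^ 2
      ≤ ∑ m : ZMod (4 * l * f ^ 2), if f ^ 2 ∣ m.val then (1 : ℝ) else 0 := by
        refine sum_le_sum fun m _ => ?_
        split_ifs with h
        · exact pow_le_one₀ (norm_nonneg _) (norm_discWeight_le_one _ _ _)
        · rw [discWeightMod, discWeight, if_neg, norm_zero]
          · simp
          · rintro ⟨h', -⟩
            exact h (by exact_mod_cast h')
    _ = #{m : ZMod (4 * l * f ^ 2) | f ^ 2 ∣ m.val} := by simp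
    _ ≤ 4 * l := by exact_mod_cast hcard

/-- `Kl` as a function of the residue of `4 n` modulo `4 l f ^ 2`. -/
noncomputable def klMod (l f : ℕ) [NeZero (4 * l * f ^ 2)] (ξ : ℤ) (t : ZMod (4 * l * f ^ 2)) : ℂ :=
  ∑ a : ZMod (4 * l * f ^ 2), ZMod.stdAddChar ((ξ : ZMod (4 * l * f ^ 2)) * a) *
    discWeightMod l f (a ^ 2 - t)

theorem Kl_eq_klMod {l f : ℕ} [NeZero (4 * l * f ^ 2)] (hf : 0 < f) (ξ : ℤ) (n : ℕ) :
    Kl l f ξ n = klMod l f ξ ((4 * n : ℤ) : ZMod (4 * l * f ^ 2)) := by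
  rw [Kl, klMod, sum_filter]
  refine sum_nbij' (fun a => (a : ZMod (4 * l * f ^ 2))) ZMod.val ?_ ?_ ?_ ?_ ?_
  · simp
  · intro a _
    exact mem_range.2 (ZMod.val_lt a)
  · intro a ha
    exact ZMod.val_natCast_of_lt (mem_range.1 ha)
  · intro a _
    exact ZMod.natCast_zmod_val a
  · intro a _
    have h1 : ((a : ZMod (4 * l * f ^ 2)) ^ 2 - ((4 * n : ℤ) : ZMod (4 * l * f ^ 2))) =
        (((a : ℤ) ^ 2 - 4 * n : ℤ) : ZMod (4 * l * f ^ 2)) := by push_cast; ring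
    have h2 : ((ξ : ZMod (4 * l * f ^ 2)) * (a : ZMod (4 * l * f ^ 2))) =
        ((ξ * a : ℤ) : ZMod (4 * l * f ^ 2)) := by push_cast; ring
    rw [h1, discWeightMod_intCast hf, h2, ZMod.stdAddChar_coe, discWeight]
    split_ifs
    · rw [mul_comm, e]
      congr 2
      push_cast
      ring
    · simp

theorem sum_norm_sq_klMod_le {l f : ℕ} [NeZero (4 * l * f ^ 2)] (ξ : ℤ) :
    ∑ t, ‖klMod l f ξ t‖ ^ 2 ≤
      ((4 * l * f ^ 2 : ℕ) : ℝ) * Int.gcd (2 * ξ) (4 * l * f ^ 2 : ℕ) * (4 * l) := by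
  refine (sum_norm_sq_correlation_le _ (discWeightMod l f) (fun a => a ^ 2)
    (norm_sq_gaussSum_le ξ)).trans ?_
  gcongr
  exact sum_norm_sq_discWeightMod_le

/-- Within one period the classes `4 (n₀ + n)` are distinct modulo `4 l f ^ 2`, so the mean square
over all classes dominates and Cauchy–Schwarz applies. -/
theorem norm_sum_klMod_le_of_le {l f r : ℕ} [NeZero (4 * l * f ^ 2)] (ξ n₀ : ℤ)
    (hr : r ≤ l * f ^ 2) :
    ‖∑ n ∈ range r, klMod l f ξ ((4 * (n₀ + n) : ℤ) : ZMod (4 * l * f ^ 2))‖ ≤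
      4 * (l * f ^ 2) * √(l * Int.gcd (2 * ξ) (4 * l * f ^ 2 : ℕ)) := by
  set g : ℕ := Int.gcd (2 * ξ) (4 * l * f ^ 2 : ℕ) with hg
  have h1 : ∑ n ∈ range r, ‖klMod l f ξ ((4 * (n₀ + n) : ℤ) : ZMod (4 * l * f ^ 2))‖ ^ 2 ≤
      ∑ t, ‖klMod l f ξ t‖ ^ 2 := by
    rw [← sum_image (g := fun n : ℕ => ((4 * (n₀ + n) : ℤ) : ZMod (4 * l * f ^ 2)))
      (f := fun t => ‖klMod l f ξ t‖ ^ 2)]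
    · exact sum_le_sum_of_subset_of_nonneg (subset_univ _) fun _ _ _ => by positivity
    · intro a ha b hb hab
      have ha' := mem_range.1 ha
      have hb' := mem_range.1 hb
      simp only [ZMod.intCast_eq_intCast_iff] at hab
      obtain ⟨c, hc⟩ := Int.modEq_iff_dvd.1 hab
      push_cast at hc
      have hc' : (b : ℤ) - a = l * f ^ 2 * c := by linarith
      have habs : |(b : ℤ) - a| < ((l * f ^ 2 : ℕ) : ℤ) := by
        rw [abs_lt]
        constructor <;> omega
      have : (b : ℤ) - a = 0 := by
        apply Int.eq_zero_of_abs_lt_dvd _ habs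
        exact ⟨c, by rw [hc']; push_cast; ring⟩
      omega
  have h2 : ‖∑ n ∈ range r, klMod l f ξ ((4 * (n₀ + n) : ℤ) : ZMod (4 * l * f ^ 2))‖ ^ 2 ≤
      (4 * (l * f ^ 2) * √(l * g)) ^ 2 := by
    calc ‖∑ n ∈ range r, klMod l f ξ ((4 * (n₀ + n) : ℤ) : ZMod (4 * l * f ^ 2))‖ ^ 2
        ≤ (∑ n ∈ range r, ‖klMod l f ξ ((4 * (n₀ + n) : ℤ) : ZMod (4 * l * f ^ 2))‖) ^ 2 := by
          gcongr
          exact norm_sum_le _ _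
      _ ≤ (#(range r) : ℝ) *
          ∑ n ∈ range r, ‖klMod l f ξ ((4 * (n₀ + n) : ℤ) : ZMod (4 * l * f ^ 2))‖ ^ 2 :=
        sq_sum_le_card_mul_sum_sq
      _ ≤ ((l * f ^ 2 : ℕ) : ℝ) * (((4 * l * f ^ 2 : ℕ) : ℝ) * g * (4 * l)) := by
        gcongr
        · simpa using hr
        · exact h1.trans (sum_norm_sq_klMod_le ξ)
      _ = (4 * (l * f ^ 2) * √(l * g)) ^ 2 := by
        rw [mul_pow, Real.sq_sqrt (by positivity)]
        push_cast
        ring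
  exact le_of_sq_le_sq h2 (by positivity)

theorem periodic_sum_range {N : ℕ} {G : ℤ → ℂ} (hG : Function.Periodic G N) :
    Function.Periodic (fun n₀ : ℤ => ∑ n ∈ range N, G (n₀ + n)) 1 := by
  intro n₀
  have h1 := sum_range_succ (fun n : ℕ => G (n₀ + n)) N
  have h2 := sum_range_succ' (fun n : ℕ => G (n₀ + n)) N
  rw [h1] at h2
  simp only [Nat.cast_add, Nat.cast_one, Nat.cast_zero, add_zero] at h2
  rw [hG n₀] at h2
  have h3 := add_right_cancel h2
  simp only
  rw [h3]
  refine sum_congr rfl fun n _ => ?_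
  ring_nf

/-- Since `(a + 2) ^ 2 = a ^ 2 + 4 (a + 1)`, moving `a` by `2` amounts to a translation of `n`,
invisible in a sum over a full period. The same move multiplies the whole sum by `e(2 ξ / q)`, which
differs from `1`. -/
theorem sum_period_klMod_eq_zero {l f : ℕ} [NeZero (4 * l * f ^ 2)] {ξ : ℤ}
    (hξ : ¬ ((4 * l * f ^ 2 : ℕ) : ℤ) ∣ 2 * ξ) (n₀ : ℤ) :
    ∑ n ∈ range (l * f ^ 2), klMod l f ξ ((4 * (n₀ + n) : ℤ) : ZMod (4 * l * f ^ 2)) = 0 := by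
  set q := 4 * l * f ^ 2 with hq
  set Φ : ZMod q → ℂ := fun a => ∑ n ∈ range (l * f ^ 2),
    discWeightMod l f (a ^ 2 - ((4 * (n₀ + n) : ℤ) : ZMod q)) with hΦ
  have hΦ2 : ∀ a, Φ (a + 2) = Φ a := by
    intro a
    set G : ℤ → ℂ := fun n => discWeightMod l f (a ^ 2 - ((4 * n : ℤ) : ZMod q)) with hG
    have hper : Function.Periodic G (l * f ^ 2 : ℕ) := by
      intro n
      have : ((4 * (n + (l * f ^ 2 : ℕ)) : ℤ) : ZMod q) = ((4 * n : ℤ) : ZMod q) := by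
        have h0 : ((q : ℕ) : ZMod q) = 0 := ZMod.natCast_self q
        rw [hq] at h0
        push_cast at h0 ⊢
        linear_combination h0
      simp only [hG, this]
    -- Translating `n` by `-(a + 1)` absorbs `4 (a + 1)`.
    have h1 := (periodic_sum_range hper).int_mul (-(a.val : ℤ) - 1) n₀
    simp only [mul_one] at h1
    simp only [hΦ]
    refine Eq.trans ?_ h1
    refine sum_congr rfl fun n _ => ?_
    simp only [hG]
    congr 1
    push_cast
    rw [ZMod.natCast_zmod_val]
    ring
  have hS : ∑ n ∈ range (l * f ^ 2), klMod l f ξ ((4 * (n₀ + n) : ℤ) : ZMod q) =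
      ∑ a : ZMod q, ZMod.stdAddChar ((ξ : ZMod q) * a) * Φ a := by
    simp only [klMod, hΦ, mul_sum]
    rw [sum_comm]
  rw [hS]
  set T := ∑ a : ZMod q, ZMod.stdAddChar ((ξ : ZMod q) * a) * Φ a with hT
  have hshift : T = ZMod.stdAddChar ((ξ : ZMod q) * 2) * T := by
    conv_lhs => rw [hT, ← Equiv.sum_comp (Equiv.addRight (2 : ZMod q))]
    rw [hT, mul_sum]
    refine sum_congr rfl fun a _ => ?_
    simp only [Equiv.coe_addRight, hΦ2, mul_add, AddChar.map_add_eq_mul]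
    ring
  have hne : (ZMod.stdAddChar ((ξ : ZMod q) * 2) : ℂ) ≠ 1 := by
    intro h
    rw [← AddChar.map_zero_eq_one (ZMod.stdAddChar (N := q))] at h
    have h4 := ZMod.injective_stdAddChar h
    apply hξ
    rw [← ZMod.intCast_zmod_eq_zero_iff_dvd]
    push_cast
    rw [mul_comm]
    exact h4
  have h0 : (ZMod.stdAddChar ((ξ : ZMod q) * 2) - 1) * T = 0 := by
    rw [sub_mul, ← hshift]; ring
  exact (mul_eq_zero.1 h0).resolve_left (sub_ne_zero.2 hne)

/-- Full periods are peeled off one at a time. Taking `A = 0` records that they vanish, while `A =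
1` pays the one-block bound for each. -/
theorem norm_sum_klMod_le {l f : ℕ} [NeZero (4 * l * f ^ 2)] (ξ : ℤ) {r : ℕ}
    (hr : r ≤ l * f ^ 2) {A : ℝ} (hA : 0 ≤ A)
    (hξ : ((4 * l * f ^ 2 : ℕ) : ℤ) ∣ 2 * ξ → 1 ≤ A) (k : ℕ) (n₀ : ℤ) :
    ‖∑ n ∈ range (l * f ^ 2 * k + r),
      klMod l f ξ ((4 * (n₀ + n) : ℤ) : ZMod (4 * l * f ^ 2))‖ ≤
      (1 + A * k) * (4 * (l * f ^ 2) * √(l * Int.gcd (2 * ξ) (4 * l * f ^ 2 : ℕ))) := by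
  induction k generalizing n₀ with
  | zero => simpa using norm_sum_klMod_le_of_le ξ n₀ hr
  | succ k ih =>
    have hidx : l * f ^ 2 * (k + 1) + r = l * f ^ 2 + (l * f ^ 2 * k + r) := by ring
    rw [hidx, sum_range_add]
    have h2 := ih (n₀ + (l * f ^ 2 : ℕ))
    have hB : 0 ≤ 4 * (l * f ^ 2) * √(l * (Int.gcd (2 * ξ) (4 * l * f ^ 2 : ℕ) : ℝ)) := by
      positivity
    set B := 4 * (l * f ^ 2) * √(l * (Int.gcd (2 * ξ) (4 * l * f ^ 2 : ℕ) : ℝ))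
    have h1 : ‖∑ n ∈ range (l * f ^ 2),
        klMod l f ξ ((4 * (n₀ + n) : ℤ) : ZMod (4 * l * f ^ 2))‖ ≤ A * B := by
      by_cases h : ((4 * l * f ^ 2 : ℕ) : ℤ) ∣ 2 * ξ
      · exact (norm_sum_klMod_le_of_le ξ n₀ le_rfl).trans (le_mul_of_one_le_left hB (hξ h))
      · rw [sum_period_klMod_eq_zero h, norm_zero]
        positivity
    refine (norm_add_le _ _).trans ?_
    have h3 : ∑ x ∈ range (l * f ^ 2 * k + r),
        klMod l f ξ ((4 * (n₀ + (l * f ^ 2 + x : ℕ)) : ℤ) : ZMod (4 * l * f ^ 2)) =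
        ∑ n ∈ range (l * f ^ 2 * k + r),
        klMod l f ξ ((4 * (n₀ + (l * f ^ 2 : ℕ) + n) : ℤ) : ZMod (4 * l * f ^ 2)) := by
      refine sum_congr rfl fun n _ => ?_
      rw [Nat.cast_add, add_assoc]
    rw [h3]
    push_cast at h1 h2 ⊢
    linarith

/-- Partial sums of `Kl` over `n`. The factor `1 + A m` is needed only when `4 l f ^ 2 ∣ 2 ξ`,
where complete sums do not vanish. -/
theorem norm_sum_Kl_le {l f : ℕ} (hl : 0 < l) (hf : 0 < f) (ξ : ℤ) {A : ℝ} (hA : 0 ≤ A)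
    (hξ : ((4 * l * f ^ 2 : ℕ) : ℤ) ∣ 2 * ξ → 1 ≤ A) (m : ℕ) :
    ‖∑ n ∈ range m, Kl l f ξ (n + 1)‖ ≤
      (1 + A * m) * (4 * (l * f ^ 2) * √(l * Int.gcd (2 * ξ) (4 * l * f ^ 2 : ℕ))) := by
  have : NeZero (4 * l * f ^ 2) := ⟨by positivity⟩
  have hN : 0 < l * f ^ 2 := by positivity
  have h1 := norm_sum_klMod_le ξ (Nat.mod_lt m hN).le hA hξ (m / (l * f ^ 2)) 1
  rw [Nat.div_add_mod] at h1
  have h2 : ∑ n ∈ range m, Kl l f ξ (n + 1) =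
      ∑ n ∈ range m, klMod l f ξ ((4 * (1 + n) : ℤ) : ZMod (4 * l * f ^ 2)) := by
    refine sum_congr rfl fun n _ => ?_
    rw [Kl_eq_klMod hf]
    push_cast
    ring_nf
  rw [h2]
  refine h1.trans ?_
  gcongr
  exact Nat.div_le_self _ _

end BeyondEndoscopy

/-! ### The Bessel kernel, its Mellin transform, and the cut-off `F`. -/

namespace BeyondEndoscopy

open scoped Real Topology
open MeasureTheory Set Filter

/-- The kernel of the Bessel function `K_s(2)`, whose Mellin transform is `2 K_s(2)`. -/
noncomputable def besselKernel (x : ℝ) : ℝ := Real.exp (-x - 1 / x)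

theorem besselKernel_pos (x : ℝ) : 0 < besselKernel x := Real.exp_pos _

/-- With `z = x + 1 / x` the kernel is `exp(-z)`, which beats every power of `z`. Powers of `x` of
either sign are bounded by powers of `z`, so one estimate serves at both `0` and `∞`. -/
theorem exists_rpow_mul_besselKernel_le (a : ℝ) :
    ∃ C : ℝ, 0 < C ∧ ∀ x : ℝ, 0 < x → x ^ a * besselKernel x ≤ C / (1 + x ^ 2) := by
  obtain ⟨n, hn⟩ := exists_nat_ge |a|
  refine ⟨(n + 2).factorial, by positivity, fun x hx => ?_⟩
  set z := x + 1 / x with hz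
  have hz0 : 0 < z := by positivity
  have hinv : 0 < 1 / x := by positivity
  have h1 : x ^ a ≤ z ^ n := by
    rcases le_total 1 x with h | h
    · calc x ^ a ≤ x ^ (n : ℝ) := Real.rpow_le_rpow_of_exponent_le h ((le_abs_self a).trans hn)
        _ = x ^ n := Real.rpow_natCast _ _
        _ ≤ z ^ n := by gcongr; linarith
    · calc x ^ a ≤ x ^ (-(n : ℝ)) :=
            Real.rpow_le_rpow_of_exponent_ge hx h ((neg_le_neg hn).trans (neg_abs_le a))
        _ = (1 / x) ^ n := by rw [Real.rpow_neg hx.le, Real.rpow_natCast, one_div, inv_pow]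
        _ ≤ z ^ n := by gcongr; linarith
  have h2 : besselKernel x ≤ (n + 2).factorial / z ^ (n + 2) := by
    have h3 := Real.pow_div_factorial_le_exp z hz0.le (n + 2)
    have h4 : besselKernel x = (Real.exp z)⁻¹ := by
      rw [← Real.exp_neg, besselKernel, hz]; ring_nf
    rw [h4, ← inv_div]
    exact inv_anti₀ (by positivity) h3
  have h5 : 1 + x ^ 2 ≤ z ^ 2 := by
    have : x * (1 / x) = 1 := by field_simp
    nlinarith
  calc x ^ a * besselKernel x ≤ z ^ n * ((n + 2).factorial / z ^ (n + 2)) := by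
        gcongr
        exact (besselKernel_pos x).le
    _ = (n + 2).factorial / z ^ 2 := by rw [pow_add]; field_simp
    _ ≤ (n + 2).factorial / (1 + x ^ 2) := by gcongr

theorem continuousOn_besselKernel : ContinuousOn besselKernel (Ioi 0) := by
  intro x hx
  have : x ≠ 0 := (ne_of_gt hx)
  exact ContinuousAt.continuousWithinAt (by unfold besselKernel; fun_prop (disch := assumption))

theorem continuousOn_cpow_mul_besselKernel (s : ℂ) :
    ContinuousOn (fun x : ℝ => (x : ℂ) ^ s * (besselKernel x : ℂ)) (Ioi 0) := by
  refine ContinuousOn.mul ?_ (Complex.continuous_ofReal.comp_continuousOn continuousOn_besselKernel)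
  intro x hx
  exact (Complex.continuousAt_ofReal_cpow_const _ _ (Or.inr (ne_of_gt hx))).continuousWithinAt

theorem norm_cpow_mul_besselKernel (s : ℂ) {x : ℝ} (hx : 0 < x) :
    ‖(x : ℂ) ^ s * (besselKernel x : ℂ)‖ = x ^ s.re * besselKernel x := by
  rw [norm_mul, Complex.norm_cpow_eq_rpow_re_of_pos hx, Complex.norm_real,
    Real.norm_of_nonneg (besselKernel_pos x).le]

theorem integrableOn_cpow_mul_besselKernel (s : ℂ) :
    IntegrableOn (fun x : ℝ => (x : ℂ) ^ s * (besselKernel x : ℂ)) (Ioi 0) := by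
  obtain ⟨C, -, hC⟩ := exists_rpow_mul_besselKernel_le s.re
  refine Integrable.mono' (g := fun x => C * (1 + x ^ 2)⁻¹)
    (integrable_inv_one_add_sq.const_mul C).integrableOn
    ((continuousOn_cpow_mul_besselKernel s).aestronglyMeasurable measurableSet_Ioi) ?_
  filter_upwards [ae_restrict_mem measurableSet_Ioi] with x hx
  rw [norm_cpow_mul_besselKernel s hx, ← div_eq_mul_inv]
  exact hC x hx

theorem tendsto_const_div_one_add_sq (C : ℝ) :
    Tendsto (fun x : ℝ => C / (1 + x ^ 2)) atTop (𝓝 0) :=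
  Tendsto.div_atTop tendsto_const_nhds
    (tendsto_atTop_add_const_left _ _ (tendsto_pow_atTop two_ne_zero))

theorem tendsto_cpow_mul_besselKernel_atTop (s : ℂ) :
    Tendsto (fun x : ℝ => (x : ℂ) ^ s * (besselKernel x : ℂ)) atTop (𝓝 0) := by
  obtain ⟨C, -, hC⟩ := exists_rpow_mul_besselKernel_le s.re
  refine squeeze_zero_norm' ?_ (tendsto_const_div_one_add_sq C)
  filter_upwards [eventually_gt_atTop 0] with x hx
  rw [norm_cpow_mul_besselKernel s hx]
  exact hC x hx

theorem tendsto_cpow_mul_besselKernel_zero (s : ℂ) :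
    Tendsto (fun x : ℝ => (x : ℂ) ^ s * (besselKernel x : ℂ)) (𝓝[>] 0) (𝓝 0) := by
  obtain ⟨C, hC0, hC⟩ := exists_rpow_mul_besselKernel_le (s.re - 1)
  have hlim : Tendsto (fun x : ℝ => C * x) (𝓝[>] 0) (𝓝 0) := by
    have : Tendsto (fun x : ℝ => C * x) (𝓝 0) (𝓝 (C * 0)) := (continuous_const_mul C).tendsto 0
    rw [mul_zero] at this
    exact this.mono_left nhdsWithin_le_nhds
  refine squeeze_zero_norm' ?_ hlim
  filter_upwards [self_mem_nhdsWithin] with x hx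
  have hx : 0 < x := hx
  rw [norm_cpow_mul_besselKernel s hx]
  have h1 : x ^ s.re = x ^ (s.re - 1) * x := by
    rw [← Real.rpow_add_one hx.ne', sub_add_cancel]
  calc x ^ s.re * besselKernel x = x ^ (s.re - 1) * besselKernel x * x := by rw [h1]; ring
    _ ≤ C / (1 + x ^ 2) * x := by gcongr; exact hC x hx
    _ ≤ C * x := by
      gcongr
      exact div_le_self hC0.le (by nlinarith [sq_nonneg x])

/-- The Mellin transform of `besselKernel`, that is `2 K_s(2)`. -/
noncomputable def besselMellin (s : ℂ) : ℂ :=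
  ∫ x in Ioi (0 : ℝ), (x : ℂ) ^ (s - 1) * (besselKernel x : ℂ)

theorem hasDerivAt_besselKernel {x : ℝ} (hx : x ≠ 0) :
    HasDerivAt besselKernel (besselKernel x * (-1 + 1 / x ^ 2)) x := by
  have h : HasDerivAt (fun x : ℝ => -x - 1 / x) (-1 + 1 / x ^ 2) x := by
    have := (hasDerivAt_id x).neg.sub (hasDerivAt_inv hx)
    refine (this.congr_of_eventuallyEq (Eventually.of_forall fun y => ?_)).congr_deriv ?_
    · simp [one_div]
    · rw [one_div]; ring
  exact h.exp

/-- Integration by parts, the logarithmic derivative of the kernel being `-1 + 1 / x ^ 2`. This is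
the recurrence of `K_s` in its order. -/
theorem besselMellin_recurrence (s : ℂ) :
    s * besselMellin s = besselMellin (s + 1) - besselMellin (s - 1) := by
  have hint := integrableOn_cpow_mul_besselKernel
  have hpow : ∀ x ∈ Ioi (0 : ℝ), (x : ℂ) ^ s * ((besselKernel x * (-1 + 1 / x ^ 2) : ℝ) : ℂ) =
      (x : ℂ) ^ (s - 1 - 1) * (besselKernel x : ℂ) - (x : ℂ) ^ (s + 1 - 1) * (besselKernel x : ℂ) := by
    intro x hx
    have hx0 : (x : ℂ) ≠ 0 := Complex.ofReal_ne_zero.2 (ne_of_gt hx)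
    rw [Complex.cpow_sub _ _ hx0, Complex.cpow_sub _ _ hx0, add_sub_cancel_right, Complex.cpow_one]
    push_cast
    field_simp
    ring
  have hu : ∀ x ∈ Ioi (0 : ℝ), HasDerivAt (fun x : ℝ => (x : ℂ) ^ s) (s * (x : ℂ) ^ (s - 1)) x := by
    intro x hx
    by_cases hs : s = 0
    · simpa [hs] using hasDerivAt_const x (1 : ℂ)
    · have := hasDerivAt_ofReal_cpow_const' (ne_of_gt hx) (r := s - 1)
        (by intro h; exact hs (by linear_combination h))
      simp only [sub_add_cancel] at this
      have h2 := this.const_mul s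
      refine h2.congr_of_eventuallyEq (Eventually.of_forall fun y => ?_)
      simp only
      field_simp
  have hIBP := integral_Ioi_mul_deriv_eq_deriv_mul (a := (0 : ℝ)) (a' := (0 : ℂ)) (b' := (0 : ℂ))
    (u := fun x : ℝ => (x : ℂ) ^ s) (u' := fun x : ℝ => s * (x : ℂ) ^ (s - 1))
    (v := fun x : ℝ => (besselKernel x : ℂ))
    (v' := fun x : ℝ => ((besselKernel x * (-1 + 1 / x ^ 2) : ℝ) : ℂ)) hu
    (fun x hx => (hasDerivAt_besselKernel (ne_of_gt hx)).ofReal_comp)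
    (((hint (s - 1 - 1)).sub (hint (s + 1 - 1))).congr_fun
      (fun x hx => (hpow x hx).symm) measurableSet_Ioi)
    (by
      refine ((hint (s - 1)).const_mul s).congr (Eventually.of_forall fun x => ?_)
      simp only [Pi.mul_apply]
      ring)
    (tendsto_cpow_mul_besselKernel_zero s) (tendsto_cpow_mul_besselKernel_atTop s)
  rw [setIntegral_congr_fun measurableSet_Ioi hpow,
    integral_sub (hint (s - 1 - 1)) (hint (s + 1 - 1))] at hIBP
  simp_rw [mul_assoc] at hIBP
  rw [integral_const_mul] at hIBP
  unfold besselMellin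
  linear_combination hIBP

/-- Each use of the recurrence gains a factor `|t|` and moves the line by `±1`, so the induction
runs over all `σ` at once. -/
theorem exists_norm_besselMellin_mul_pow_le (j : ℕ) (σ : ℝ) :
    ∃ C : ℝ, ∀ t : ℝ, ‖besselMellin (σ + t * Complex.I)‖ * |t| ^ j ≤ C := by
  induction j generalizing σ with
  | zero =>
    refine ⟨∫ x in Ioi (0 : ℝ), ‖(x : ℂ) ^ ((σ : ℂ) - 1) * (besselKernel x : ℂ)‖, fun t => ?_⟩
    rw [pow_zero, mul_one, besselMellin]
    refine (norm_integral_le_integral_norm _).trans (le_of_eq ?_)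
    refine setIntegral_congr_fun measurableSet_Ioi fun x hx => ?_
    rw [norm_cpow_mul_besselKernel _ hx, norm_cpow_mul_besselKernel _ hx]
    simp
  | succ j ih =>
    obtain ⟨C₁, h₁⟩ := ih (σ + 1)
    obtain ⟨C₂, h₂⟩ := ih (σ - 1)
    refine ⟨C₁ + C₂, fun t => ?_⟩
    have ht : |t| ≤ ‖(σ : ℂ) + t * Complex.I‖ := by
      simpa using Complex.abs_im_le_norm ((σ : ℂ) + t * Complex.I)
    have e₁ : (σ : ℂ) + t * Complex.I + 1 = ((σ + 1 : ℝ) : ℂ) + t * Complex.I := by push_cast; ring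
    have e₂ : (σ : ℂ) + t * Complex.I - 1 = ((σ - 1 : ℝ) : ℂ) + t * Complex.I := by push_cast; ring
    have hrec := besselMellin_recurrence (σ + t * Complex.I)
    rw [e₁, e₂] at hrec
    calc ‖besselMellin (σ + t * Complex.I)‖ * |t| ^ (j + 1)
        = |t| * ‖besselMellin (σ + t * Complex.I)‖ * |t| ^ j := by ring
      _ ≤ ‖(σ : ℂ) + t * Complex.I‖ * ‖besselMellin (σ + t * Complex.I)‖ * |t| ^ j := by gcongr
      _ = ‖besselMellin ((σ + 1 : ℝ) + t * Complex.I) -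
            besselMellin ((σ - 1 : ℝ) + t * Complex.I)‖ * |t| ^ j := by rw [← norm_mul, hrec]
      _ ≤ (‖besselMellin ((σ + 1 : ℝ) + t * Complex.I)‖ +
            ‖besselMellin ((σ - 1 : ℝ) + t * Complex.I)‖) * |t| ^ j := by
          gcongr
          exact norm_sub_le _ _
      _ ≤ C₁ + C₂ := by
          rw [add_mul]
          exact add_le_add (h₁ t) (h₂ t)

theorem integrableOn_rpow_mul_besselKernel (a : ℝ) :
    IntegrableOn (fun x : ℝ => x ^ a * besselKernel x) (Ioi 0) := by
  have h : IntegrableOn (fun x : ℝ => ‖(x : ℂ) ^ (a : ℂ) * (besselKernel x : ℂ)‖) (Ioi 0) :=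
    (integrableOn_cpow_mul_besselKernel a).norm
  refine h.congr_fun (fun x hx => ?_) measurableSet_Ioi
  simpa using norm_cpow_mul_besselKernel a hx

theorem integrableOn_besselKernel_div :
    IntegrableOn (fun x : ℝ => besselKernel x / x) (Ioi 0) := by
  refine (integrableOn_rpow_mul_besselKernel (-1)).congr_fun (fun x hx => ?_) measurableSet_Ioi
  simp only
  rw [Real.rpow_neg_one, mul_comm, div_eq_mul_inv]

theorem F_eq (x : ℝ) : F x = 1 / (2 * besselK0 2) * ∫ y in Ioi x, besselKernel y / y := rfl

/-- On the range of integration `x ^ 2 ≤ y ^ 2`, so `x ^ 2` can be moved under the integral, where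
the kernel absorbs it. -/
theorem exists_abs_F_le : ∃ C : ℝ, ∀ x : ℝ, 0 < x → |F x| ≤ C / (1 + x ^ 2) := by
  set J₀ := ∫ y in Ioi (0 : ℝ), besselKernel y / y
  set J₂ := ∫ y in Ioi (0 : ℝ), y ^ (1 : ℝ) * besselKernel y
  refine ⟨|1 / (2 * besselK0 2)| * (J₀ + J₂), fun x hx => ?_⟩
  have hsub : Ioi x ⊆ Ioi (0 : ℝ) := Ioi_subset_Ioi hx.le
  have hnn : ∀ y ∈ Ioi (0 : ℝ), 0 ≤ besselKernel y / y := fun y hy =>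
    div_nonneg (besselKernel_pos y).le (le_of_lt hy)
  have hI : 0 ≤ ∫ y in Ioi x, besselKernel y / y :=
    setIntegral_nonneg measurableSet_Ioi fun y hy => hnn y (hsub hy)
  have h0 : ∫ y in Ioi x, besselKernel y / y ≤ J₀ := by
    refine setIntegral_mono_set integrableOn_besselKernel_div ?_ hsub.eventuallyLE
    filter_upwards [ae_restrict_mem measurableSet_Ioi] with y hy using hnn y hy
  have h2 : x ^ 2 * ∫ y in Ioi x, besselKernel y / y ≤ J₂ := by
    rw [← integral_const_mul]
    calc ∫ y in Ioi x, x ^ 2 * (besselKernel y / y)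
        ≤ ∫ y in Ioi x, y ^ (1 : ℝ) * besselKernel y := by
          refine setIntegral_mono_on
            ((integrableOn_besselKernel_div.mono_set hsub).const_mul _)
            ((integrableOn_rpow_mul_besselKernel 1).mono_set hsub) measurableSet_Ioi fun y hy => ?_
          have hy : x < y := hy
          have hy0 : 0 < y := hx.trans hy
          rw [Real.rpow_one, ← mul_div_assoc, div_le_iff₀ hy0]
          have h3 : x ^ 2 ≤ y * y := by nlinarith
          nlinarith [mul_le_mul_of_nonneg_right h3 (besselKernel_pos y).le]
      _ ≤ J₂ := by
          refine setIntegral_mono_set (integrableOn_rpow_mul_besselKernel 1) ?_ hsub.eventuallyLE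
          filter_upwards [ae_restrict_mem measurableSet_Ioi] with y hy
          exact mul_nonneg (Real.rpow_nonneg (le_of_lt hy) _) (besselKernel_pos y).le
  rw [F_eq, abs_mul, abs_of_nonneg hI, le_div_iff₀ (by positivity), mul_assoc]
  gcongr
  linarith

theorem F_sub_F {x y : ℝ} (hx : 0 < x) (hy : 0 < y) :
    F x - F y = 1 / (2 * besselK0 2) * ∫ t in x..y, besselKernel t / t := by
  rw [F_eq, F_eq, ← mul_sub, intervalIntegral.integral_Ioi_sub_Ioi'
    (integrableOn_besselKernel_div.mono_set (Ioi_subset_Ioi hx.le))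
    (integrableOn_besselKernel_div.mono_set (Ioi_subset_Ioi hy.le))]

theorem besselKernel_le_one {x : ℝ} (hx : 0 < x) : besselKernel x ≤ 1 := by
  rw [besselKernel, Real.exp_le_one_iff]
  have : 0 < 1 / x := by positivity
  linarith

/-- The kernel is at most `1`, so the integrand is dominated by `1 / t`, whose integral is the
difference of logarithms. -/
theorem abs_F_sub_F_le {x y : ℝ} (hx : 0 < x) (hy : 0 < y) :
    |F x - F y| ≤ |1 / (2 * besselK0 2)| * |Real.log x - Real.log y| := by
  rw [F_sub_F hx hy, abs_mul]
  refine mul_le_mul_of_nonneg_left ?_ (abs_nonneg _)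
  wlog hxy : x ≤ y generalizing x y
  · rw [intervalIntegral.integral_symm, abs_neg, abs_sub_comm]
    exact this hy hx (le_of_not_ge hxy)
  have hpos : ∀ t ∈ Icc x y, 0 < t := fun t ht => hx.trans_le ht.1
  have hlog : ∫ t in x..y, (1 / t) = Real.log y - Real.log x := by
    rw [integral_one_div_of_pos hx hy, Real.log_div hy.ne' hx.ne']
  have hc1 : IntervalIntegrable (fun t => besselKernel t / t) volume x y := by
    apply ContinuousOn.intervalIntegrable
    rw [uIcc_of_le hxy]
    exact (continuousOn_besselKernel.mono fun t ht => hpos t ht).div continuousOn_id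
      fun t ht => (hpos t ht).ne'
  have hc2 : IntervalIntegrable (fun t : ℝ => 1 / t) volume x y := by
    apply ContinuousOn.intervalIntegrable
    rw [uIcc_of_le hxy]
    exact continuousOn_const.div continuousOn_id fun t ht => (hpos t ht).ne'
  rw [abs_of_nonneg (intervalIntegral.integral_nonneg hxy fun t ht =>
    div_nonneg (besselKernel_pos t).le (hpos t ht).le), abs_sub_comm]
  refine le_trans ?_ (le_abs_self _)
  rw [← hlog]
  refine intervalIntegral.integral_mono_on hxy hc1 hc2 fun t ht => ?_
  have := hpos t ht
  gcongr
  exact besselKernel_le_one this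

theorem hasDerivAt_F {x : ℝ} (hx : 0 < x) :
    HasDerivAt F (-(1 / (2 * besselK0 2)) * (besselKernel x / x)) x := by
  have hcont : ContinuousAt (fun t => besselKernel t / t) x :=
    ((continuousOn_besselKernel.continuousAt (Ioi_mem_nhds hx)).div continuousAt_id hx.ne')
  have h1 : HasDerivAt (fun u => ∫ t in x..u, besselKernel t / t) (besselKernel x / x) x := by
    refine intervalIntegral.integral_hasDerivAt_right (by simp) ?_ hcont
    refine ContinuousOn.stronglyMeasurableAtFilter isOpen_Ioi ?_ x hx
    exact continuousOn_besselKernel.div continuousOn_id fun t ht => ne_of_gt ht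
  have h2 := (h1.const_mul (-(1 / (2 * besselK0 2)))).const_add (F x)
  refine h2.congr_of_eventuallyEq ?_
  filter_upwards [Ioi_mem_nhds hx] with y hy
  have := F_sub_F hx hy
  linarith

end BeyondEndoscopy

/-! ### The weight `F(y) + y H(y)` as a function of `log y`. -/

namespace BeyondEndoscopy

open scoped Real Topology
open MeasureTheory Set Filter

theorem continuousOn_F : ContinuousOn F (Ioi 0) := fun _ hx =>
  (hasDerivAt_F hx).continuousAt.continuousWithinAt

/-- Integration by parts: the derivative of `F` is a multiple of the kernel over `x`. Thus the
transform of `F` inherits the decay of `besselMellin`. -/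
theorem mul_mellin_F {u : ℂ} (hu : u.re = 1) :
    u * mellin (fun x : ℝ => (F x : ℂ)) u = (1 / (2 * besselK0 2) : ℝ) * besselMellin u := by
  set c : ℝ := 1 / (2 * besselK0 2) with hc
  obtain ⟨C, hC⟩ := exists_abs_F_le
  have hC0 : 0 ≤ C := by
    have := (abs_nonneg _).trans (hC 1 one_pos)
    by_contra hneg
    exact absurd this (not_le.2 (div_neg_of_neg_of_pos (not_le.1 hneg) (by norm_num)))
  have hu0 : u ≠ 0 := by
    rintro rfl
    simp at hu
  have hFint : IntegrableOn (fun x : ℝ => (x : ℂ) ^ (u - 1) * (F x : ℂ)) (Ioi 0) := by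
    refine Integrable.mono' (g := fun x => C * (1 + x ^ 2)⁻¹)
      (integrable_inv_one_add_sq.const_mul C).integrableOn ?_ ?_
    · refine ContinuousOn.aestronglyMeasurable (ContinuousOn.mul ?_
        (Complex.continuous_ofReal.comp_continuousOn continuousOn_F)) measurableSet_Ioi
      intro x hx
      exact (Complex.continuousAt_ofReal_cpow_const _ _ (Or.inr (ne_of_gt hx))).continuousWithinAt
    · filter_upwards [ae_restrict_mem measurableSet_Ioi] with x hx
      rw [norm_mul, Complex.norm_cpow_eq_rpow_re_of_pos hx, Complex.norm_real, ← div_eq_mul_inv]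
      simpa [hu] using hC x hx
  have hnorm : ∀ x : ℝ, 0 < x → ‖(x : ℂ) ^ u * (F x : ℂ)‖ ≤ x * (C / (1 + x ^ 2)) := by
    intro x hx
    rw [norm_mul, Complex.norm_cpow_eq_rpow_re_of_pos hx, Complex.norm_real, hu, Real.rpow_one]
    gcongr
    exact hC x hx
  have hlim0 : Tendsto (fun x : ℝ => (x : ℂ) ^ u * (F x : ℂ)) (𝓝[>] 0) (𝓝 0) := by
    have hlim : Tendsto (fun x : ℝ => x * (C / (1 + x ^ 2))) (𝓝[>] 0) (𝓝 0) := by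
      have hcont : Continuous (fun x : ℝ => x * (C / (1 + x ^ 2))) := by
        refine continuous_id.mul (continuous_const.div (by fun_prop) fun x => by positivity)
      have := hcont.tendsto 0
      rw [zero_mul] at this
      exact this.mono_left nhdsWithin_le_nhds
    refine squeeze_zero_norm' ?_ hlim
    filter_upwards [self_mem_nhdsWithin] with x hx using hnorm x hx
  have hlim1 : Tendsto (fun x : ℝ => (x : ℂ) ^ u * (F x : ℂ)) atTop (𝓝 0) := by
    have hlim : Tendsto (fun x : ℝ => C * x⁻¹) atTop (𝓝 0) := by
      simpa using tendsto_inv_atTop_zero.const_mul C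
    refine squeeze_zero_norm' ?_ hlim
    filter_upwards [eventually_gt_atTop 0] with x hx
    refine (hnorm x hx).trans ?_
    rw [← div_eq_mul_inv, ← mul_div_assoc, div_le_div_iff₀ (by positivity) hx]
    nlinarith
  have hpow : ∀ x ∈ Ioi (0 : ℝ), (x : ℂ) ^ u * ((-c * (besselKernel x / x) : ℝ) : ℂ) =
      -(c : ℂ) * ((x : ℂ) ^ (u - 1) * (besselKernel x : ℂ)) := by
    intro x hx
    have hx0 : (x : ℂ) ≠ 0 := Complex.ofReal_ne_zero.2 (ne_of_gt hx)
    rw [Complex.cpow_sub _ _ hx0, Complex.cpow_one]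
    push_cast
    field_simp
  have hder : ∀ x ∈ Ioi (0 : ℝ),
      HasDerivAt (fun x : ℝ => (x : ℂ) ^ u) (u * (x : ℂ) ^ (u - 1)) x := by
    intro x hx
    have := hasDerivAt_ofReal_cpow_const' (ne_of_gt hx) (r := u - 1)
      (by intro h; exact hu0 (by linear_combination h))
    simp only [sub_add_cancel] at this
    refine (this.const_mul u).congr_of_eventuallyEq (Eventually.of_forall fun y => ?_)
    simp only
    field_simp
  have hint := integrableOn_cpow_mul_besselKernel (u - 1)
  have hIBP := integral_Ioi_mul_deriv_eq_deriv_mul (a := (0 : ℝ)) (a' := (0 : ℂ)) (b' := (0 : ℂ))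
    (u := fun x : ℝ => (x : ℂ) ^ u) (u' := fun x : ℝ => u * (x : ℂ) ^ (u - 1))
    (v := fun x : ℝ => (F x : ℂ))
    (v' := fun x : ℝ => ((-c * (besselKernel x / x) : ℝ) : ℂ)) hder
    (fun x hx => (hasDerivAt_F hx).ofReal_comp)
    (IntegrableOn.congr_fun (Integrable.const_mul hint (-(c : ℂ)))
      (fun x hx => (hpow x hx).symm) measurableSet_Ioi)
    (by
      refine (Integrable.const_mul hFint u).congr (Eventually.of_forall fun x => ?_)
      simp only [Pi.mul_apply]
      ring)
    hlim0 hlim1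
  rw [setIntegral_congr_fun measurableSet_Ioi hpow, integral_const_mul] at hIBP
  simp_rw [mul_assoc] at hIBP
  rw [integral_const_mul] at hIBP
  simp only [mellin, smul_eq_mul, besselMellin]
  linear_combination hIBP

theorem continuous_besselMellin_vertical (σ : ℝ) :
    Continuous fun t : ℝ => besselMellin (σ + t * Complex.I) := by
  unfold besselMellin
  refine continuous_of_dominated
    (bound := fun x : ℝ => ‖(x : ℂ) ^ ((σ : ℂ) - 1) * (besselKernel x : ℂ)‖)
    (fun t => (integrableOn_cpow_mul_besselKernel _).aestronglyMeasurable)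
    (fun t => ?_) (integrableOn_cpow_mul_besselKernel _).norm ?_
  · filter_upwards [ae_restrict_mem measurableSet_Ioi] with x hx
    rw [norm_cpow_mul_besselKernel _ hx, norm_cpow_mul_besselKernel _ hx]
    simp
  · filter_upwards [ae_restrict_mem measurableSet_Ioi] with x hx
    have hx0 : (x : ℂ) ≠ 0 := Complex.ofReal_ne_zero.2 (ne_of_gt hx)
    refine Continuous.mul (Continuous.const_cpow (by fun_prop) (Or.inl hx0)) continuous_const

/-- The beta integral at `(1 + i y, 1 / 2)` is bounded by its value at `y = 0`, and it links `Γ(1 +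
i y)` to `Γ(3 / 2 + i y) = (1 / 2 + i y) Γ(1 / 2 + i y)`. This polynomial bound replaces Stirling's
formula. -/
theorem exists_norm_Gamma_le :
    ∃ C : ℝ, 0 ≤ C ∧ ∀ y : ℝ,
      ‖Complex.Gamma (1 + y * Complex.I)‖ ≤
        C * (1 + |y|) * ‖Complex.Gamma (1 / 2 + y * Complex.I)‖ := by
  set B : ℝ := ∫ x in (0 : ℝ)..1, ‖(x : ℂ) ^ ((1 : ℂ) - 1) * (1 - (x : ℂ)) ^ ((1 / 2 : ℂ) - 1)‖
    with hB
  have hB0 : 0 ≤ B := intervalIntegral.integral_nonneg zero_le_one fun _ _ => norm_nonneg _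
  have hG : 0 < ‖Complex.Gamma (1 / 2)‖ :=
    norm_pos_iff.2 (Complex.Gamma_ne_zero_of_re_pos (by norm_num))
  refine ⟨B / ‖Complex.Gamma (1 / 2)‖, by positivity, fun y => ?_⟩
  have hbeta : ‖Complex.betaIntegral (1 + y * Complex.I) (1 / 2)‖ ≤ B := by
    rw [Complex.betaIntegral]
    refine (intervalIntegral.norm_integral_le_integral_norm zero_le_one).trans (le_of_eq ?_)
    rw [hB, intervalIntegral.integral_of_le zero_le_one, intervalIntegral.integral_of_le zero_le_one]
    refine setIntegral_congr_fun measurableSet_Ioc fun x hx => ?_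
    simp only [norm_mul]
    rw [Complex.norm_cpow_eq_rpow_re_of_pos hx.1, Complex.norm_cpow_eq_rpow_re_of_pos hx.1]
    simp
  have h1 := Complex.Gamma_mul_Gamma_eq_betaIntegral (s := 1 + y * Complex.I) (t := 1 / 2)
    (by simp) (by norm_num)
  have h2 : (1 : ℂ) + y * Complex.I + 1 / 2 = (1 / 2 + y * Complex.I) + 1 := by ring
  have hne : (1 / 2 : ℂ) + y * Complex.I ≠ 0 := by
    intro h
    have := congrArg Complex.re h
    norm_num at this
  rw [h2, Complex.Gamma_add_one _ hne] at h1
  have h3 := congrArg norm h1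
  rw [norm_mul, norm_mul, norm_mul] at h3
  have h4 : ‖(1 / 2 : ℂ) + y * Complex.I‖ ≤ 1 + |y| := by
    refine (norm_add_le _ _).trans ?_
    rw [norm_mul, Complex.norm_I, Complex.norm_real, mul_one, Real.norm_eq_abs]
    gcongr
    norm_num
  rw [div_mul_eq_mul_div, div_mul_eq_mul_div, le_div_iff₀ hG, h3]
  calc _ ≤ (1 + |y|) * ‖Complex.Gamma (1 / 2 + y * Complex.I)‖ * B := by gcongr
    _ = _ := by ring

/-- The Mellin transform of `H` on the line `Re u = 1`, without the factor `√π π ^ (-u)`. -/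
noncomputable def dualMellin (t : ℝ) : ℂ :=
  Complex.Gamma ((1 + ((1 : ℝ) + t * Complex.I)) / 2) /
    Complex.Gamma ((2 - ((1 : ℝ) + t * Complex.I)) / 2) *
    mellin (fun x : ℝ => (F x : ℂ)) ((1 : ℝ) + t * Complex.I)

theorem continuous_dualMellin : Continuous dualMellin := by
  unfold dualMellin
  have hG : ∀ (f : ℝ → ℂ), Continuous f → (∀ t, 0 < (f t).re) →
      Continuous fun t => Complex.Gamma (f t) := by
    intro f hf hpos
    rw [continuous_iff_continuousAt]
    intro t
    refine ContinuousAt.comp (g := Complex.Gamma)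
      (Complex.differentiableAt_Gamma _ ?_).continuousAt hf.continuousAt
    intro m h
    have h1 := hpos t
    rw [h] at h1
    simp only [Complex.neg_re, Complex.natCast_re, Left.neg_pos_iff] at h1
    exact absurd h1 (not_lt.2 (Nat.cast_nonneg m))
  refine Continuous.mul (Continuous.div (hG _ (by fun_prop) ?_) (hG _ (by fun_prop) ?_) ?_) ?_
  · intro t; norm_num
  · intro t; norm_num
  · intro t
    refine Complex.Gamma_ne_zero_of_re_pos ?_
    norm_num
  · have hne : ∀ t : ℝ, ((1 : ℝ) : ℂ) + t * Complex.I ≠ 0 := by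
      intro t h
      have := congrArg Complex.re h
      norm_num at this
    have heq : (fun t : ℝ => mellin (fun x : ℝ => (F x : ℂ)) ((1 : ℝ) + t * Complex.I)) =
        fun t : ℝ => (1 / (2 * besselK0 2) : ℝ) * besselMellin ((1 : ℝ) + t * Complex.I) /
          ((1 : ℝ) + t * Complex.I) := by
      ext t
      rw [← mul_mellin_F (by simp), mul_div_cancel_left₀ _ (hne t)]
    rw [heq]
    exact (continuous_const.mul (continuous_besselMellin_vertical 1)).div (by fun_prop) hne

theorem exists_norm_dualMellin_le :
    ∃ C : ℝ, ∀ t : ℝ, (1 + |t|) * ‖dualMellin t‖ ≤ C * (1 + t ^ 2)⁻¹ := by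
  obtain ⟨CG, hCG0, hCG⟩ := exists_norm_Gamma_le
  obtain ⟨C₀, h₀⟩ := exists_norm_besselMellin_mul_pow_le 0 1
  obtain ⟨C₄, h₄⟩ := exists_norm_besselMellin_mul_pow_le 4 1
  set c : ℝ := 1 / (2 * besselK0 2) with hc
  refine ⟨CG * |c| * (8 * (C₀ + C₄)), fun t => ?_⟩
  set u : ℂ := (1 : ℝ) + t * Complex.I with hu
  have hratio : ‖Complex.Gamma ((1 + u) / 2) / Complex.Gamma ((2 - u) / 2)‖ ≤ CG * (1 + |t|) := by
    have e1 : (1 + u) / 2 = 1 + (t / 2 : ℝ) * Complex.I := by rw [hu]; push_cast; ring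
    have e2 : (2 - u) / 2 = (starRingEnd ℂ) (1 / 2 + (t / 2 : ℝ) * Complex.I) := by
      rw [hu, map_add, map_mul, Complex.conj_I, Complex.conj_ofReal]
      simp only [map_div₀, map_one, map_ofNat]
      push_cast
      ring
    rw [e1, e2, Complex.Gamma_conj, norm_div, RCLike.norm_conj, div_le_iff₀
      (norm_pos_iff.2 (Complex.Gamma_ne_zero_of_re_pos (by norm_num)))]
    have ht : |t / 2| ≤ |t| := by
      rw [abs_div, abs_of_pos (two_pos : (0 : ℝ) < 2)]
      linarith [abs_nonneg t]
    refine (hCG (t / 2)).trans ?_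
    gcongr
  have hmel : ‖mellin (fun x : ℝ => (F x : ℂ)) u‖ ≤ |c| * ‖besselMellin u‖ := by
    have h1 : 1 ≤ ‖u‖ := by
      have := Complex.abs_re_le_norm u
      simpa [hu] using this
    calc ‖mellin (fun x : ℝ => (F x : ℂ)) u‖ ≤ ‖u‖ * ‖mellin (fun x : ℝ => (F x : ℂ)) u‖ :=
          le_mul_of_one_le_left (norm_nonneg _) h1
      _ = |c| * ‖besselMellin u‖ := by
          rw [← norm_mul, mul_mellin_F (by simp [hu]), norm_mul, Complex.norm_real,
            Real.norm_eq_abs]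
  -- Four powers are spent: one for the weight `1 + |t|`, one for the Gamma quotient, two for
  -- integrability.
  have hbes : (1 + |t|) ^ 4 * ‖besselMellin u‖ ≤ 8 * (C₀ + C₄) := by
    have h0 := h₀ t
    have h4 := h₄ t
    rw [pow_zero, mul_one] at h0
    have hp : (1 + |t|) ^ 4 ≤ 8 * (1 + |t| ^ 4) := by
      have := abs_nonneg t
      nlinarith [sq_nonneg (|t| - 1), sq_nonneg (|t| ^ 2 - 1), mul_nonneg this (sq_nonneg (|t| - 1)),
        mul_nonneg (sq_nonneg |t|) (sq_nonneg (|t| - 1))]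
    calc (1 + |t|) ^ 4 * ‖besselMellin u‖ ≤ 8 * (1 + |t| ^ 4) * ‖besselMellin u‖ := by gcongr
      _ = 8 * (‖besselMellin u‖ + ‖besselMellin u‖ * |t| ^ 4) := by ring
      _ ≤ 8 * (C₀ + C₄) := by gcongr
  have hsq : 1 + t ^ 2 ≤ (1 + |t|) ^ 2 := by
    nlinarith [abs_nonneg t, sq_abs t]
  rw [← div_eq_mul_inv, le_div_iff₀ (by positivity)]
  have hdef : ‖dualMellin t‖ ≤ CG * (1 + |t|) * (|c| * ‖besselMellin u‖) := by
    rw [dualMellin, norm_mul]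
    gcongr
  calc (1 + |t|) * ‖dualMellin t‖ * (1 + t ^ 2)
      ≤ (1 + |t|) * (CG * (1 + |t|) * (|c| * ‖besselMellin u‖)) * (1 + |t|) ^ 2 := by gcongr
    _ = CG * |c| * ((1 + |t|) ^ 4 * ‖besselMellin u‖) := by ring
    _ ≤ CG * |c| * (8 * (C₀ + C₄)) := by gcongr

/-- On `Re u = 1` the factor `y` cancels the modulus of `y ^ (-u)`, leaving a Fourier integral in
the variable `log (π y)`. -/
theorem mul_H_eq {y : ℝ} (hy : 0 < y) :
    (y : ℂ) * H y = ((√π / (2 * π ^ 2) : ℝ) : ℂ) *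
      ∫ t : ℝ, Complex.exp (Complex.I * ((-t * Real.log (π * y) : ℝ) : ℂ)) * dualMellin t := by
  have hpy : 0 < π * y := by positivity
  have hpy0 : ((π * y : ℝ) : ℂ) ≠ 0 := Complex.ofReal_ne_zero.2 hpy.ne'
  have hint : ∀ t : ℝ, ((π * y : ℝ) : ℂ) ^ (-(((1 : ℝ) : ℂ) + t * Complex.I)) =
      ((π * y)⁻¹ : ℝ) * Complex.exp (Complex.I * ((-t * Real.log (π * y) : ℝ) : ℂ)) := by
    intro t
    rw [neg_add, Complex.cpow_add _ _ hpy0, Complex.ofReal_one, Complex.cpow_neg_one,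
      Complex.cpow_def_of_ne_zero hpy0, ← Complex.ofReal_log hpy.le]
    push_cast
    congr 2
    ring
  have hH : H y = (√π : ℝ) * ((1 / (2 * π) : ℝ) •
      ∫ t : ℝ, ((π * y : ℝ) : ℂ) ^ (-(((1 : ℝ) : ℂ) + t * Complex.I)) • dualMellin t) := rfl
  rw [hH]
  simp_rw [hint, smul_eq_mul, mul_assoc]
  rw [integral_const_mul, Complex.real_smul]
  generalize ∫ t : ℝ, Complex.exp (Complex.I * ((-t * Real.log (π * y) : ℝ) : ℂ)) *
    dualMellin t = J
  have hy0 : (y : ℂ) ≠ 0 := Complex.ofReal_ne_zero.2 hy.ne'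
  have hpi0 : (π : ℂ) ≠ 0 := Complex.ofReal_ne_zero.2 Real.pi_ne_zero
  push_cast
  field_simp

theorem norm_exp_sub_exp_le (a b : ℝ) :
    ‖Complex.exp (Complex.I * (a : ℂ)) - Complex.exp (Complex.I * (b : ℂ))‖ ≤ |a - b| := by
  have h : Complex.exp (Complex.I * (a : ℂ)) - Complex.exp (Complex.I * (b : ℂ)) =
      Complex.exp (Complex.I * (b : ℂ)) * (Complex.exp (Complex.I * ((a - b : ℝ) : ℂ)) - 1) := by
    rw [mul_sub, ← Complex.exp_add, mul_one]
    push_cast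
    ring_nf
  rw [h, norm_mul, mul_comm Complex.I, Complex.norm_exp_ofReal_mul_I, one_mul]
  exact Real.norm_exp_I_mul_ofReal_sub_one_le

/-- The weight `F(y) + y H(y)` in the definition of `I`. -/
noncomputable def W (y : ℝ) : ℂ := (F y : ℂ) + (y : ℂ) * H y

/-- Integrability of `dualMellin` makes `y H(y)` bounded. Integrability against `|t|` makes it
Lipschitz in `log y`, the scale on which dilations act as translations. -/
theorem exists_W_bounds :
    ∃ B : ℝ, 0 ≤ B ∧ (∀ y : ℝ, 0 < y → ‖W y‖ ≤ B) ∧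
      ∀ x y : ℝ, 0 < x → 0 < y → ‖W x - W y‖ ≤ B * |Real.log x - Real.log y| := by
  obtain ⟨CF, hCF⟩ := exists_abs_F_le
  obtain ⟨CD, hCD⟩ := exists_norm_dualMellin_le
  have hD1 : Integrable (fun t : ℝ => (1 + |t|) * ‖dualMellin t‖) := by
    refine Integrable.mono' (integrable_inv_one_add_sq.const_mul CD)
      (Continuous.aestronglyMeasurable (by have := continuous_dualMellin; fun_prop)) ?_
    refine Eventually.of_forall fun t => ?_
    rw [Real.norm_of_nonneg (by positivity)]
    exact hCD t
  have hosc : ∀ z : ℝ, Integrable fun t : ℝ =>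
      Complex.exp (Complex.I * ((-t * z : ℝ) : ℂ)) * dualMellin t := by
    intro z
    refine Integrable.mono' hD1 (Continuous.aestronglyMeasurable
      (by have := continuous_dualMellin; fun_prop)) (Eventually.of_forall fun t => ?_)
    rw [norm_mul, mul_comm Complex.I, Complex.norm_exp_ofReal_mul_I, one_mul]
    exact le_mul_of_one_le_left (norm_nonneg _) (by linarith [abs_nonneg t])
  set D : ℝ := ∫ t : ℝ, (1 + |t|) * ‖dualMellin t‖ with hD
  have hD0 : 0 ≤ D := integral_nonneg fun t => by positivity
  set c : ℝ := √π / (2 * π ^ 2) with hc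
  have hc0 : 0 ≤ c := by positivity
  have hCF0 : 0 ≤ CF := by
    have := (abs_nonneg _).trans (hCF 1 one_pos)
    by_contra hneg
    exact absurd this (not_le.2 (div_neg_of_neg_of_pos (not_le.1 hneg) (by norm_num)))
  refine ⟨CF + |1 / (2 * besselK0 2)| + c * D, by positivity, fun y hy => ?_, fun x y hx hy => ?_⟩
  · rw [W]
    have h1 : ‖(F y : ℂ)‖ ≤ CF := by
      rw [Complex.norm_real, Real.norm_eq_abs]
      exact (hCF y hy).trans (div_le_self hCF0 (by nlinarith [sq_nonneg y]))
    have h2 : ‖(y : ℂ) * H y‖ ≤ c * D := by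
      rw [mul_H_eq hy, norm_mul, Complex.norm_real, Real.norm_of_nonneg hc0]
      refine mul_le_mul_of_nonneg_left ?_ hc0
      refine norm_integral_le_of_norm_le hD1 (Eventually.of_forall fun t => ?_)
      rw [norm_mul, mul_comm Complex.I, Complex.norm_exp_ofReal_mul_I, one_mul]
      exact le_mul_of_one_le_left (norm_nonneg _) (by linarith [abs_nonneg t])
    refine (norm_add_le _ _).trans ?_
    linarith [abs_nonneg (1 / (2 * besselK0 2))]
  · set L := |Real.log x - Real.log y| with hL
    have hL0 : 0 ≤ L := abs_nonneg _
    have h1 : ‖((F x : ℂ) - (F y : ℂ))‖ ≤ |1 / (2 * besselK0 2)| * L := by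
      rw [← Complex.ofReal_sub, Complex.norm_real]
      exact abs_F_sub_F_le hx hy
    have h2 : ‖(x : ℂ) * H x - (y : ℂ) * H y‖ ≤ c * (L * D) := by
      rw [mul_H_eq hx, mul_H_eq hy, ← mul_sub, norm_mul, Complex.norm_real, Real.norm_of_nonneg hc0]
      refine mul_le_mul_of_nonneg_left ?_ hc0
      rw [← integral_sub (hosc _) (hosc _), hD, ← integral_const_mul]
      refine norm_integral_le_of_norm_le (hD1.const_mul L) (Eventually.of_forall fun t => ?_)
      rw [← sub_mul, norm_mul, ← mul_assoc]
      refine mul_le_mul_of_nonneg_right ((norm_exp_sub_exp_le _ _).trans ?_) (norm_nonneg _)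
      rw [Real.log_mul Real.pi_ne_zero hx.ne', Real.log_mul Real.pi_ne_zero hy.ne', ← mul_sub,
        add_sub_add_left_eq_sub, abs_mul, abs_neg, mul_comm]
      gcongr
      linarith
    have h3 : W x - W y = ((F x : ℂ) - (F y : ℂ)) + ((x : ℂ) * H x - (y : ℂ) * H y) := by
      rw [W, W]; ring
    rw [h3]
    refine (norm_add_le _ _).trans ?_
    have : 0 ≤ CF * L := by positivity
    linarith

end BeyondEndoscopy

/-! ### The oscillatory integral `I` and its variation in `n`. -/

namespace BeyondEndoscopy

open scoped Real Topology
open MeasureTheory Set Filter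

theorem norm_e (x : ℝ) : ‖e x‖ = 1 := by
  have : (2 * π * Complex.I * x : ℂ) = ((2 * π * x : ℝ) : ℂ) * Complex.I := by push_cast; ring
  rw [e, this, Complex.norm_exp_ofReal_mul_I]

theorem continuous_e : Continuous e := by
  unfold e
  fun_prop

theorem exists_pow_add_I_mul_eq (m : ℕ) :
    ∃ A B : Polynomial ℂ, ∀ z s : ℂ, s ^ 2 = 1 - z ^ 2 →
      (z + Complex.I * s) ^ m = A.eval z + Complex.I * s * B.eval z := by
  induction m with
  | zero => exact ⟨1, 0, fun z s _ => by simp⟩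
  | succ m ih =>
    obtain ⟨A, B, h⟩ := ih
    refine ⟨A * Polynomial.X - (1 - Polynomial.X ^ 2) * B, A + Polynomial.X * B, fun z s hs => ?_⟩
    rw [pow_succ, h z s hs]
    simp only [Polynomial.eval_sub, Polynomial.eval_mul, Polynomial.eval_X, Polynomial.eval_one,
      Polynomial.eval_pow, Polynomial.eval_add]
    linear_combination (s ^ 2 * Polynomial.eval z B) * Complex.I_sq - Polynomial.eval z B * hs

theorem sqrt_one_sub_sq_eq_zero {x : ℝ} (hx : 1 ≤ |x|) : √(1 - x ^ 2) = 0 :=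
  Real.sqrt_eq_zero'.2 (by rw [← sq_abs]; nlinarith)

theorem sqrt_one_sub_sq_pos {x : ℝ} (hx : |x| < 1) : 0 < √(1 - x ^ 2) :=
  Real.sqrt_pos.2 (by rw [← sq_abs]; nlinarith [abs_nonneg x])

/-- With `x = cos φ` this is `-(1 / π) sin((k - 1) φ)`, that is, `sin φ` times a Chebyshev
polynomial of the second kind. The factor `√(1 - x ^ 2)` compensates for the singular argument of
`W` at `±1`. -/
theorem exists_thetaInf_eq (k : ℕ) :
    ∃ B : Polynomial ℂ, ∀ x : ℝ, thetaInf k x = (√(1 - x ^ 2) : ℝ) * B.eval (x : ℂ) := by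
  obtain ⟨A, B, h⟩ := exists_pow_add_I_mul_eq (k - 1)
  refine ⟨Polynomial.C (-(1 / π : ℂ)) * B, fun x => ?_⟩
  rw [thetaInf]
  split_ifs with hx
  · set s : ℝ := √(1 - x ^ 2) with hs
    have hs2 : (s : ℂ) ^ 2 = 1 - (x : ℂ) ^ 2 := by
      have h1 : s ^ 2 = 1 - x ^ 2 := Real.sq_sqrt (by rw [← sq_abs]; nlinarith [abs_nonneg x])
      exact_mod_cast h1
    have h1 := h x s hs2
    have h2 := h x (-s) (by rw [neg_sq, hs2])
    rw [mul_neg, ← sub_eq_add_neg] at h2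
    rw [h1, h2, Polynomial.eval_mul, Polynomial.eval_C]
    have hpi : (π : ℂ) ≠ 0 := Complex.ofReal_ne_zero.2 Real.pi_ne_zero
    field_simp
    linear_combination (2 * s * Polynomial.eval (x : ℂ) B) * Complex.I_sq
  · rw [sqrt_one_sub_sq_eq_zero (not_lt.1 hx)]
    simp

theorem exists_polynomial_bounds (B : Polynomial ℂ) :
    ∃ A : ℝ, 0 ≤ A ∧ (∀ x : ℝ, |x| ≤ 1 → ‖B.eval (x : ℂ)‖ ≤ A) ∧
      ∀ x y : ℝ, |x| ≤ 1 → |y| ≤ 1 → ‖B.eval (x : ℂ) - B.eval (y : ℂ)‖ ≤ A * |x - y| := by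
  have hcont : ∀ Q : Polynomial ℂ, Continuous fun x : ℝ => Q.eval (x : ℂ) := fun Q => by fun_prop
  obtain ⟨A₁, h₁⟩ := isCompact_Icc.exists_bound_of_continuousOn
    (s := Icc (-1 : ℝ) 1) (hcont B).continuousOn
  obtain ⟨A₂, h₂⟩ := isCompact_Icc.exists_bound_of_continuousOn
    (s := Icc (-1 : ℝ) 1) (hcont B.derivative).continuousOn
  have hA₁ : 0 ≤ A₁ := (norm_nonneg _).trans (h₁ 0 (by simp))
  have hA₂ : 0 ≤ A₂ := (norm_nonneg _).trans (h₂ 0 (by simp))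
  refine ⟨A₁ + A₂, by positivity, fun x hx => (h₁ x (abs_le.1 hx)).trans (by linarith),
    fun x y hx hy => ?_⟩
  have := (convex_Icc (-1 : ℝ) 1).norm_image_sub_le_of_norm_hasDerivWithin_le
    (f := fun x : ℝ => B.eval (x : ℂ)) (f' := fun x : ℝ => B.derivative.eval (x : ℂ))
    (fun z _ => ((B.hasDerivAt (z : ℂ)).comp_ofReal).hasDerivWithinAt) h₂
    (abs_le.1 hy) (abs_le.1 hx)
  refine this.trans ?_
  rw [Real.norm_eq_abs]
  gcongr
  linarith

theorem continuousOn_W : ContinuousOn W (Ioi 0) := by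
  obtain ⟨B, -, -, hB⟩ := exists_W_bounds
  intro x hx
  have hx : 0 < x := hx
  refine ContinuousAt.continuousWithinAt ?_
  rw [ContinuousAt, tendsto_iff_norm_sub_tendsto_zero]
  have hlim : Tendsto (fun y => B * |Real.log y - Real.log x|) (𝓝 x) (𝓝 0) := by
    have hc : ContinuousAt (fun y => B * |Real.log y - Real.log x|) x :=
      (((Real.continuousAt_log hx.ne').sub continuousAt_const).abs).const_mul B
    simpa [ContinuousAt] using hc
  refine squeeze_zero' (Eventually.of_forall fun _ => norm_nonneg _) ?_ hlim
  filter_upwards [Ioi_mem_nhds hx] with y hy using hB y x hy hx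

/-- The amplitude of the oscillatory integral `I`. -/
noncomputable def amplitude (k : ℕ) (c x : ℝ) : ℂ := thetaInf k x * W (c / √(1 - x ^ 2))

theorem integrable_sqrt_one_sub_sq : Integrable fun x : ℝ => √(1 - x ^ 2) := by
  refine Continuous.integrable_of_hasCompactSupport (by fun_prop)
    (HasCompactSupport.of_support_subset_isCompact (K := Icc (-1) 1) isCompact_Icc fun x hx => ?_)
  by_contra h
  refine hx (sqrt_one_sub_sq_eq_zero ?_)
  by_contra h'
  exact h (abs_le.1 (not_le.1 h').le)

theorem amplitude_eq_zero (k : ℕ) (c : ℝ) {x : ℝ} (hx : 1 ≤ |x|) : amplitude k c x = 0 := by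
  rw [amplitude, thetaInf, if_neg (not_lt.2 hx), zero_mul]

/-- The amplitude is bounded, and nearly invariant under simultaneous dilation of its arguments,
in `L¹` and uniformly in `c`. -/
theorem exists_amplitude_bounds (k : ℕ) :
    ∃ C : ℝ, 0 ≤ C ∧ (∀ c x : ℝ, 0 < c → ‖amplitude k c x‖ ≤ C * √(1 - x ^ 2)) ∧
      ∀ c r x : ℝ, 0 < c → 1 ≤ r →
        ‖amplitude k c x - r * amplitude k (r * c) (r * x)‖ ≤
          C * ((√(1 - x ^ 2) - √(1 - (r * x) ^ 2)) + (r - 1) * √(1 - (r * x) ^ 2)) := by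
  obtain ⟨P, hP⟩ := exists_thetaInf_eq k
  obtain ⟨A, hA0, hA, hAL⟩ := exists_polynomial_bounds P
  obtain ⟨B, hB0, hB, hBL⟩ := exists_W_bounds
  have hbound : ∀ c x : ℝ, 0 < c → ‖amplitude k c x‖ ≤ A * B * √(1 - x ^ 2) := by
    intro c x hc
    rcases lt_or_ge |x| 1 with hx | hx
    · have hs := sqrt_one_sub_sq_pos hx
      rw [amplitude, hP, norm_mul, norm_mul, Complex.norm_real, Real.norm_of_nonneg hs.le]
      calc √(1 - x ^ 2) * ‖P.eval (x : ℂ)‖ * ‖W (c / √(1 - x ^ 2))‖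
          ≤ √(1 - x ^ 2) * A * B := by
            gcongr
            · exact hA x hx.le
            · exact hB _ (by positivity)
        _ = A * B * √(1 - x ^ 2) := by ring
    · rw [amplitude_eq_zero k c hx, norm_zero]
      positivity
  refine ⟨3 * (A * B), by positivity, fun c x hc => (hbound c x hc).trans ?_,
    fun c r x hc hr => ?_⟩
  · have : 0 ≤ A * B := by positivity
    exact mul_le_mul_of_nonneg_right (by linarith) (Real.sqrt_nonneg _)
  have hr0 : 0 < r := by linarith
  rcases lt_or_ge |r * x| 1 with hrx | hrx
  · have hx : |x| < 1 := by
      refine lt_of_le_of_lt ?_ hrx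
      rw [abs_mul, abs_of_pos hr0]
      exact le_mul_of_one_le_left (abs_nonneg x) hr
    have hs1 := sqrt_one_sub_sq_pos hx
    have hs2 := sqrt_one_sub_sq_pos hrx
    have hle : √(1 - (r * x) ^ 2) ≤ √(1 - x ^ 2) := by
      apply Real.sqrt_le_sqrt
      have : x ^ 2 * 1 ≤ x ^ 2 * r ^ 2 := by gcongr; exact one_le_pow₀ hr
      rw [mul_pow]
      linarith
    rw [amplitude, amplitude, hP, hP]
    set s₁ := √(1 - x ^ 2)
    set s₂ := √(1 - (r * x) ^ 2)
    set w₁ := W (c / s₁)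
    set w₂ := W (r * c / s₂)
    set p₁ := P.eval (x : ℂ)
    set p₂ := P.eval ((r * x : ℝ) : ℂ)
    -- The logarithmic increment is at most `s₁ / s₂ - 1 + (r - 1)`, which is unbounded near the
    -- endpoint. The factor `s₂` from `thetaInf` turns its first part into the integrable difference
    -- `s₁ - s₂`.
    have hw : s₂ * ‖w₁ - w₂‖ ≤ B * ((s₁ - s₂) + (r - 1) * s₂) := by
      have h1 := hBL (c / s₁) (r * c / s₂) (by positivity) (by positivity)
      have h2 : |Real.log (c / s₁) - Real.log (r * c / s₂)| ≤ (s₁ / s₂ - 1) + (r - 1) := by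
        have e1 : Real.log (c / s₁) - Real.log (r * c / s₂) =
            -(Real.log (s₁ / s₂) + Real.log r) := by
          rw [Real.log_div hc.ne' hs1.ne', Real.log_div (by positivity) hs2.ne',
            Real.log_mul hr0.ne' hc.ne', Real.log_div hs1.ne' hs2.ne']
          ring
        rw [e1, abs_neg, abs_of_nonneg (add_nonneg (Real.log_nonneg ((one_le_div hs2).2 hle))
          (Real.log_nonneg hr))]
        exact add_le_add (Real.log_le_sub_one_of_pos (by positivity))
          (Real.log_le_sub_one_of_pos hr0)
      calc s₂ * ‖w₁ - w₂‖ ≤ s₂ * (B * ((s₁ / s₂ - 1) + (r - 1))) := by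
            gcongr
            exact h1.trans (by gcongr)
        _ = B * ((s₁ - s₂) + (r - 1) * s₂) := by field_simp
    have hp1 : ‖p₁‖ ≤ A := hA x hx.le
    have hp2 : ‖p₂‖ ≤ A := hA (r * x) hrx.le
    have hp12 : ‖p₁ - p₂‖ ≤ A * (r - 1) := by
      refine (hAL x (r * x) hx.le hrx.le).trans ?_
      gcongr
      have : x - r * x = -((r - 1) * x) := by ring
      rw [this, abs_neg, abs_mul, abs_of_nonneg (by linarith)]
      exact mul_le_of_le_one_right (by linarith) hx.le
    have hw1 : ‖w₁‖ ≤ B := hB _ (by positivity)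
    have hw2 : ‖w₂‖ ≤ B := hB _ (by positivity)
    have hdecomp : (s₁ : ℂ) * p₁ * w₁ - r * ((s₂ : ℂ) * p₂ * w₂) =
        ((s₁ - s₂ : ℝ) : ℂ) * (p₁ * w₁) + (s₂ : ℂ) * ((p₁ - p₂) * w₁) +
          ((s₂ : ℂ) * (w₁ - w₂)) * p₂ - ((r - 1 : ℝ) : ℂ) * (s₂ * (p₂ * w₂)) := by
      push_cast
      ring
    have hd0 : 0 ≤ s₁ - s₂ := by linarith
    have hr1 : 0 ≤ r - 1 := by linarith
    have t1 : ‖((s₁ - s₂ : ℝ) : ℂ) * (p₁ * w₁)‖ ≤ (s₁ - s₂) * (A * B) := by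
      rw [norm_mul, norm_mul, Complex.norm_real, Real.norm_of_nonneg hd0]
      gcongr
    have t2 : ‖(s₂ : ℂ) * ((p₁ - p₂) * w₁)‖ ≤ s₂ * (A * (r - 1) * B) := by
      rw [norm_mul, norm_mul, Complex.norm_real, Real.norm_of_nonneg hs2.le]
      gcongr
    have t3 : ‖((s₂ : ℂ) * (w₁ - w₂)) * p₂‖ ≤ B * ((s₁ - s₂) + (r - 1) * s₂) * A := by
      rw [norm_mul, norm_mul, Complex.norm_real, Real.norm_of_nonneg hs2.le]
      gcongr
    have t4 : ‖((r - 1 : ℝ) : ℂ) * (s₂ * (p₂ * w₂))‖ ≤ (r - 1) * (s₂ * (A * B)) := by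
      rw [norm_mul, norm_mul, norm_mul, Complex.norm_real, Complex.norm_real,
        Real.norm_of_nonneg hs2.le, Real.norm_of_nonneg hr1]
      gcongr
    rw [hdecomp]
    have h4 := norm_sub_le (((s₁ - s₂ : ℝ) : ℂ) * (p₁ * w₁) + (s₂ : ℂ) * ((p₁ - p₂) * w₁) +
          ((s₂ : ℂ) * (w₁ - w₂)) * p₂) (((r - 1 : ℝ) : ℂ) * (s₂ * (p₂ * w₂)))
    have h3 := norm_add₃_le (a := ((s₁ - s₂ : ℝ) : ℂ) * (p₁ * w₁))
      (b := (s₂ : ℂ) * ((p₁ - p₂) * w₁)) (c := ((s₂ : ℂ) * (w₁ - w₂)) * p₂)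
    have hpos : 0 ≤ A * B * (s₁ - s₂) := by positivity
    nlinarith
  · rw [amplitude_eq_zero k _ hrx, mul_zero, sub_zero, sqrt_one_sub_sq_eq_zero hrx, mul_zero,
      add_zero, sub_zero]
    have : 0 ≤ A * B := by positivity
    exact (hbound c x hc).trans
      (mul_le_mul_of_nonneg_right (by linarith) (Real.sqrt_nonneg _))

theorem aestronglyMeasurable_amplitude (k : ℕ) {c : ℝ} (hc : 0 < c) :
    AEStronglyMeasurable (amplitude k c) := by
  obtain ⟨P, hP⟩ := exists_thetaInf_eq k
  have hcont : ContinuousOn (amplitude k c) (Ioo (-1) 1) := by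
    unfold amplitude
    simp_rw [hP]
    refine ContinuousOn.mul (Continuous.continuousOn (by fun_prop)) ?_
    refine continuousOn_W.comp (ContinuousOn.div continuousOn_const
      (Continuous.continuousOn (by fun_prop)) fun x hx => (sqrt_one_sub_sq_pos (abs_lt.2 hx)).ne') ?_
    intro x hx
    have := sqrt_one_sub_sq_pos (abs_lt.2 hx)
    exact div_pos hc this
  have hind : amplitude k c = (Ioo (-1) 1).indicator (amplitude k c) := by
    symm
    rw [indicator_eq_self]
    intro x hx
    by_contra h
    exact hx (amplitude_eq_zero k c (not_lt.1 fun h' => h (abs_lt.1 h')))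
  rw [hind, aestronglyMeasurable_indicator_iff measurableSet_Ioo]
  exact hcont.aestronglyMeasurable measurableSet_Ioo

theorem integrable_amplitude (k : ℕ) {c : ℝ} (hc : 0 < c) : Integrable (amplitude k c) := by
  obtain ⟨C, -, hC, -⟩ := exists_amplitude_bounds k
  exact Integrable.mono' (integrable_sqrt_one_sub_sq.const_mul C)
    (aestronglyMeasurable_amplitude k hc) (Eventually.of_forall fun x => hC c x hc)

/-- The oscillatory integral `I` in terms of `c = l f ^ 2 / √(4 n)`. -/
noncomputable def oscInt (k : ℕ) (ξ c : ℝ) : ℂ := ∫ x : ℝ, amplitude k c x * e (-(x / c * ξ / 4))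

theorem I_eq_oscInt (k : ℕ) {l f n : ℕ} (hl : 0 < l) (hf : 0 < f) (hn : 0 < n) (ξ : ℤ) :
    I k l f ξ n = oscInt k ξ ((l : ℝ) * f ^ 2 / √(4 * n)) := by
  rw [I, oscInt, intervalIntegral.integral_of_le (neg_le_self zero_le_one)]
  have hn' : (0 : ℝ) < n := Nat.cast_pos.2 hn
  have hsq : √(4 * (n : ℝ)) = 2 * √n := by
    rw [Real.sqrt_mul (by norm_num), show (4 : ℝ) = 2 ^ 2 by norm_num, Real.sqrt_sq (by norm_num)]
  have hsupp : ∀ x ∉ Ioc (-1 : ℝ) 1, amplitude k ((l : ℝ) * f ^ 2 / √(4 * n)) x *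
      e (-(x / ((l : ℝ) * f ^ 2 / √(4 * n)) * ξ / 4)) = 0 := by
    intro x hx
    rw [amplitude_eq_zero, zero_mul]
    by_contra h
    have := abs_lt.1 (not_le.1 h)
    exact hx ⟨this.1, this.2.le⟩
  rw [← setIntegral_eq_integral_of_forall_compl_eq_zero hsupp]
  · refine setIntegral_congr_fun measurableSet_Ioc fun x _ => ?_
    have harg : -x * ξ * √n / (2 * l * f ^ 2) =
        -(x / ((l : ℝ) * f ^ 2 / √(4 * n)) * ξ / 4) := by
      have hs : 0 < √(n : ℝ) := Real.sqrt_pos.2 hn'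
      have hl' : (0 : ℝ) < l := Nat.cast_pos.2 hl
      have hf' : (0 : ℝ) < f := Nat.cast_pos.2 hf
      rw [hsq]
      field_simp
      ring
    simp only [amplitude, W, harg]

/-- Dilating `x` by `r` in the second integral matches the phases exactly, so only the `L¹`
variation of the amplitude counts and the bound does not see `ξ`. -/
theorem exists_oscInt_bounds (k : ℕ) :
    ∃ C : ℝ, 0 ≤ C ∧ (∀ ξ c : ℝ, 0 < c → ‖oscInt k ξ c‖ ≤ C) ∧
      ∀ ξ c r : ℝ, 0 < c → 1 ≤ r → ‖oscInt k ξ c - oscInt k ξ (r * c)‖ ≤ C * (r - 1) := by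
  obtain ⟨A, hA0, hA, hAL⟩ := exists_amplitude_bounds k
  set Q : ℝ := ∫ x : ℝ, √(1 - x ^ 2) with hQ
  have hQ0 : 0 ≤ Q := integral_nonneg fun x => Real.sqrt_nonneg _
  refine ⟨2 * (A * Q), by positivity, fun ξ c hc => ?_, fun ξ c r hc hr => ?_⟩
  · have h : ‖oscInt k ξ c‖ ≤ A * Q := by
      rw [oscInt, hQ, ← integral_const_mul]
      refine norm_integral_le_of_norm_le (integrable_sqrt_one_sub_sq.const_mul A)
        (Eventually.of_forall fun x => ?_)
      rw [norm_mul, norm_e, mul_one]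
      exact hA c x hc
    have : 0 ≤ A * Q := by positivity
    linarith
  · have hr0 : 0 < r := by linarith
    have hrc : 0 < r * c := by positivity
    have hphase : Continuous fun x : ℝ => e (-(x / c * ξ / 4)) :=
      continuous_e.comp (by fun_prop)
    have hscale : oscInt k ξ (r * c) =
        ∫ x : ℝ, (r * amplitude k (r * c) (r * x)) * e (-(x / c * ξ / 4)) := by
      have h := Measure.integral_comp_mul_left
        (fun x : ℝ => amplitude k (r * c) x * e (-(x / (r * c) * ξ / 4))) r
      simp only [mul_div_mul_left _ _ hr0.ne'] at h
      simp_rw [mul_assoc]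
      rw [integral_const_mul, h, abs_of_pos (inv_pos.2 hr0), Complex.real_smul, oscInt,
        ← mul_assoc, ← Complex.ofReal_mul, mul_inv_cancel₀ hr0.ne', Complex.ofReal_one, one_mul]
    have hmul : ∀ g : ℝ → ℂ, Integrable g →
        Integrable fun x => g x * e (-(x / c * ξ / 4)) := fun g hg =>
      hg.mul_bdd (c := 1) hphase.aestronglyMeasurable (Eventually.of_forall fun x => (norm_e _).le)
    have hi2 : Integrable fun x : ℝ => (r : ℂ) * amplitude k (r * c) (r * x) :=
      ((integrable_amplitude k hrc).comp_mul_left' hr0.ne').const_mul _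
    have hs2 : Integrable fun x : ℝ => √(1 - (r * x) ^ 2) :=
      integrable_sqrt_one_sub_sq.comp_mul_left' hr0.ne'
    have hsQ : ∫ x : ℝ, √(1 - (r * x) ^ 2) = r⁻¹ * Q := by
      have h := Measure.integral_comp_mul_left (fun x : ℝ => √(1 - x ^ 2)) r
      rw [h, abs_of_pos (inv_pos.2 hr0), smul_eq_mul]
    rw [hscale, oscInt, ← integral_sub (hmul _ (integrable_amplitude k hc)) (hmul _ hi2)]
    have hdom : ‖∫ x : ℝ, (amplitude k c x * e (-(x / c * ξ / 4)) -
        r * amplitude k (r * c) (r * x) * e (-(x / c * ξ / 4)))‖ ≤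
        ∫ x : ℝ, A * ((√(1 - x ^ 2) - √(1 - (r * x) ^ 2)) + (r - 1) * √(1 - (r * x) ^ 2)) := by
      refine norm_integral_le_of_norm_le
        (((integrable_sqrt_one_sub_sq.sub hs2).add (hs2.const_mul _)).const_mul A)
        (Eventually.of_forall fun x => ?_)
      rw [← sub_mul, norm_mul, norm_e, mul_one]
      exact hAL c r x hc hr
    refine hdom.trans ?_
    have hdiff : Integrable fun x : ℝ => √(1 - x ^ 2) - √(1 - (r * x) ^ 2) :=
      integrable_sqrt_one_sub_sq.sub hs2
    rw [integral_const_mul, integral_add hdiff (hs2.const_mul _),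
      integral_sub integrable_sqrt_one_sub_sq hs2, integral_const_mul, hsQ, ← hQ]
    have hrr : r⁻¹ * r = 1 := inv_mul_cancel₀ hr0.ne'
    have hinv : r⁻¹ ≤ 1 := inv_le_one_of_one_le₀ hr
    -- The differences of square roots are nonnegative, so they integrate exactly to `Q - Q / r`.
    have e1 : A * (Q - r⁻¹ * Q + (r - 1) * (r⁻¹ * Q)) = A * Q * (2 * (1 - r⁻¹)) := by
      linear_combination (A * Q) * hrr
    have e2 : 1 - r⁻¹ ≤ r - 1 := by
      have : 1 - r⁻¹ = r⁻¹ * (r - 1) := by linear_combination -hrr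
      rw [this]
      exact mul_le_of_le_one_left (by linarith) hinv
    rw [e1]
    have : 0 ≤ A * Q := by positivity
    nlinarith

theorem sqrt_succ_sub_sqrt_le {n : ℕ} (hn : 0 < n) : √((n : ℝ) + 1) - √n ≤ 1 / √n := by
  have hs : 0 < √(n : ℝ) := Real.sqrt_pos.2 (Nat.cast_pos.2 hn)
  have h1 : √(n : ℝ) ^ 2 = n := Real.sq_sqrt (Nat.cast_nonneg n)
  have h2 : √((n : ℝ) + 1) ^ 2 = n + 1 := Real.sq_sqrt (by positivity)
  have h3 : √(n : ℝ) ≤ √((n : ℝ) + 1) := Real.sqrt_le_sqrt (by linarith)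
  rw [le_div_iff₀ hs]
  nlinarith

/-- Passing from `n + 1` to `n` dilates `c` by `r = √((n + 1) / n)`, and `r - 1 ≤ 1 / n`. -/
theorem exists_I_bounds (k : ℕ) :
    ∃ C : ℝ, 0 ≤ C ∧ ∀ (l f : ℕ) (ξ : ℤ) (n : ℕ), 0 < l → 0 < f → 0 < n →
      ‖I k l f ξ n‖ ≤ C ∧ ‖I k l f ξ (n + 1) - I k l f ξ n‖ ≤ C / n := by
  obtain ⟨C, hC0, hC, hCL⟩ := exists_oscInt_bounds k
  refine ⟨C, hC0, fun l f ξ n hl hf hn => ?_⟩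
  have hn' : (0 : ℝ) < n := Nat.cast_pos.2 hn
  have hl' : (0 : ℝ) < l := Nat.cast_pos.2 hl
  have hf' : (0 : ℝ) < f := Nat.cast_pos.2 hf
  refine ⟨?_, ?_⟩
  · rw [I_eq_oscInt k hl hf hn]
    exact hC _ _ (by positivity)
  · rw [I_eq_oscInt k hl hf hn, I_eq_oscInt k hl hf n.succ_pos]
    have hs : 0 < √(n : ℝ) := Real.sqrt_pos.2 hn'
    have hs1 : 0 < √((n : ℝ) + 1) := Real.sqrt_pos.2 (by positivity)
    set r : ℝ := √((n : ℝ) + 1) / √n with hr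
    have h1r : 1 ≤ r := (one_le_div hs).2 (Real.sqrt_le_sqrt (by linarith))
    have hc : (l : ℝ) * f ^ 2 / √(4 * n) = r * ((l : ℝ) * f ^ 2 / √(4 * (n + 1 : ℕ))) := by
      push_cast
      rw [Real.sqrt_mul (by norm_num), Real.sqrt_mul (by norm_num), hr]
      field_simp
    rw [hc]
    refine (hCL ξ _ r (by positivity) h1r).trans ?_
    rw [div_eq_mul_one_div C]
    gcongr
    have h3 := sqrt_succ_sub_sqrt_le hn
    have h4 : r - 1 = (√((n : ℝ) + 1) - √n) / √n := by rw [hr]; field_simp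
    rw [h4, div_le_div_iff₀ hs hn']
    rw [le_div_iff₀ hs] at h3
    have h5 : √(n : ℝ) * √n = n := Real.mul_self_sqrt hn'.le
    calc (√((n : ℝ) + 1) - √n) * n = (√((n : ℝ) + 1) - √n) * √n * √n := by
          rw [mul_assoc, h5]
      _ ≤ 1 * √n := by gcongr

end BeyondEndoscopy

/-! ### Partial summation, gcd sums and harmonic sums. -/

namespace BeyondEndoscopy

open scoped Real
open Finset

theorem norm_sum_mul_le_of_partial_sums {w a : ℕ → ℂ} {M : ℝ} {m : ℕ}
    (hM : ∀ j ≤ m, ‖∑ i ∈ range j, a i‖ ≤ M) :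
    ‖∑ i ∈ range m, w i * a i‖ ≤
      M * (‖w (m - 1)‖ + ∑ i ∈ range (m - 1), ‖w (i + 1) - w i‖) := by
  have h := sum_range_by_parts w a m
  simp only [smul_eq_mul] at h
  rw [h, mul_add, mul_sum (range (m - 1)) _ M]
  refine (norm_sub_le _ _).trans (add_le_add ?_ ((norm_sum_le _ _).trans ?_))
  · rw [norm_mul, mul_comm]
    gcongr
    exact hM m le_rfl
  · refine sum_le_sum fun i hi => ?_
    rw [norm_mul, mul_comm]
    gcongr
    exact hM _ (by have := mem_range.1 hi; omega)

theorem sum_range_one_div_sqrt_le (m : ℕ) : ∑ i ∈ range m, 1 / √((i : ℝ) + 1) ≤ 2 * √m := by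
  induction m with
  | zero => simp
  | succ m ih =>
    rw [sum_range_succ]
    have h0 : 0 < √((m : ℝ) + 1) := Real.sqrt_pos.2 (by positivity)
    have h1 : √((m : ℝ) + 1) ^ 2 = m + 1 := Real.sq_sqrt (by positivity)
    have h2 : √(m : ℝ) ^ 2 = m := Real.sq_sqrt (by positivity)
    have h3 : 1 / √((m : ℝ) + 1) ≤ 2 * √((m : ℝ) + 1) - 2 * √m := by
      rw [div_le_iff₀ h0]
      nlinarith [sq_nonneg (√((m : ℝ) + 1) - √m)]
    push_cast
    linarith

/-- Removal of the smooth weight `√n I(n)` by partial summation. -/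
theorem exists_norm_sum_sqrt_mul_Kl_mul_I_le (k : ℕ) :
    ∃ C : ℝ, 0 ≤ C ∧ ∀ (l f : ℕ) (ξ : ℤ) (m : ℕ) (M : ℝ), 0 < l → 0 < f →
      (∀ j ≤ m, ‖∑ i ∈ range j, Kl l f ξ (i + 1)‖ ≤ M) →
      ‖∑ i ∈ range m, (√((i : ℝ) + 1) : ℂ) * (Kl l f ξ (i + 1) * I k l f ξ (i + 1))‖ ≤
        C * M * √m := by
  obtain ⟨C, hC0, hC⟩ := exists_I_bounds k
  -- The endpoint contributes `C √m` and the total variation `6 C √m`.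
  refine ⟨7 * C, by positivity, fun l f ξ m M hl hf hM => ?_⟩
  rcases Nat.eq_zero_or_pos m with rfl | hm
  · simp
  have hM0 : 0 ≤ M := (norm_nonneg _).trans (hM 0 (Nat.zero_le _))
  set w : ℕ → ℂ := fun i => (√((i : ℝ) + 1) : ℂ) * I k l f ξ (i + 1) with hw
  have hsum : ∑ i ∈ range m, (√((i : ℝ) + 1) : ℂ) * (Kl l f ξ (i + 1) * I k l f ξ (i + 1)) =
      ∑ i ∈ range m, w i * Kl l f ξ (i + 1) := by
    refine sum_congr rfl fun i _ => ?_
    simp only [hw]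
    ring
  have hlast : ‖w (m - 1)‖ ≤ C * √m := by
    have h1 : ((m - 1 : ℕ) : ℝ) + 1 = m := by
      rw [Nat.cast_sub hm]; simp
    simp only [hw]
    rw [norm_mul, Complex.norm_real, Real.norm_of_nonneg (Real.sqrt_nonneg _), h1, mul_comm]
    gcongr
    exact (hC l f ξ _ hl hf (Nat.succ_pos _)).1
  have hdiff : ∀ i : ℕ, ‖w (i + 1) - w i‖ ≤ 3 * C * (1 / √((i : ℝ) + 1)) := by
    intro i
    obtain ⟨hb, hd⟩ := hC l f ξ (i + 1) hl hf (Nat.succ_pos _)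
    have hs := sqrt_succ_sub_sqrt_le (Nat.succ_pos i)
    push_cast at hs hd
    set s := √((i : ℝ) + 1) with hsdef
    set s' := √((i : ℝ) + 1 + 1) with hsdef'
    have hs0 : 0 < s := Real.sqrt_pos.2 (by positivity)
    have hs0' : 0 ≤ s' := Real.sqrt_nonneg _
    have hmono : s ≤ s' := Real.sqrt_le_sqrt (by linarith)
    have hsq : s ^ 2 = (i : ℝ) + 1 := Real.sq_sqrt (by positivity)
    have h2 : s' ≤ 2 * s := by
      have h1 : 1 ≤ s ^ 2 := by rw [hsq]; linarith [Nat.cast_nonneg (α := ℝ) i]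
      have : 1 / s ≤ s := by rw [div_le_iff₀ hs0]; nlinarith
      linarith
    have hdec : w (i + 1) - w i = (s' : ℂ) * (I k l f ξ (i + 1 + 1) - I k l f ξ (i + 1)) +
        ((s' - s : ℝ) : ℂ) * I k l f ξ (i + 1) := by
      simp only [hw]
      push_cast
      ring
    rw [hdec]
    refine (norm_add_le _ _).trans ?_
    rw [norm_mul, norm_mul, Complex.norm_real, Complex.norm_real, Real.norm_of_nonneg hs0',
      Real.norm_of_nonneg (sub_nonneg.2 hmono)]
    rw [← hsq] at hd
    calc s' * ‖I k l f ξ (i + 1 + 1) - I k l f ξ (i + 1)‖ + (s' - s) * ‖I k l f ξ (i + 1)‖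
        ≤ 2 * s * (C / s ^ 2) + 1 / s * C := by gcongr
      _ = 3 * C * (1 / s) := by field_simp; ring
  rw [hsum]
  refine (norm_sum_mul_le_of_partial_sums hM).trans ?_
  have hvar : ∑ i ∈ range (m - 1), ‖w (i + 1) - w i‖ ≤ 6 * C * √m := by
    calc ∑ i ∈ range (m - 1), ‖w (i + 1) - w i‖
        ≤ ∑ i ∈ range (m - 1), 3 * C * (1 / √((i : ℝ) + 1)) := sum_le_sum fun i _ => hdiff i
      _ ≤ 3 * C * (2 * √((m - 1 : ℕ) : ℝ)) := by
          rw [← mul_sum]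
          gcongr
          exact sum_range_one_div_sqrt_le _
      _ ≤ 3 * C * (2 * √m) := by
          gcongr
          exact Nat.sub_le _ _
      _ = 6 * C * √m := by ring
  calc M * (‖w (m - 1)‖ + ∑ i ∈ range (m - 1), ‖w (i + 1) - w i‖)
      ≤ M * (C * √m + 6 * C * √m) := by gcongr
    _ = 7 * C * M * √m := by ring

/-- Write `l = d a` and `m = d b` with `d` the gcd. Then `√d / (l m) ≤ 1 / (d a b)`, and the pair is
recovered from the triple. -/
theorem sum_sqrt_gcd_div_le (U : ℕ) :
    ∑ l ∈ Icc 1 U, ∑ m ∈ Icc 1 U, √(Nat.gcd m l : ℝ) / (l * m) ≤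
      (∑ d ∈ Icc 1 U, (1 : ℝ) / d) ^ 3 := by
  classical
  set s := Icc 1 U with hs
  set G : ℕ × ℕ × ℕ → ℝ := fun p => 1 / (p.1 : ℝ) * (1 / p.2.1 * (1 / p.2.2)) with hG
  set φ : ℕ × ℕ → ℕ × ℕ × ℕ := fun p =>
    (Nat.gcd p.2 p.1, p.1 / Nat.gcd p.2 p.1, p.2 / Nat.gcd p.2 p.1) with hφ
  have hR : (∑ d ∈ s, (1 : ℝ) / d) ^ 3 = ∑ p ∈ s ×ˢ s ×ˢ s, G p := by
    rw [sum_product, pow_succ, pow_two, mul_assoc, sum_mul]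
    refine sum_congr rfl fun d _ => ?_
    rw [sum_product, sum_mul_sum, mul_sum]
    refine sum_congr rfl fun a _ => ?_
    rw [mul_sum]
  have hinj : Set.InjOn φ (s ×ˢ s : Finset (ℕ × ℕ)) := by
    rintro ⟨l, m⟩ _ ⟨l', m'⟩ _ h
    simp only [hφ, Prod.mk.injEq] at h
    obtain ⟨h1, h2, h3⟩ := h
    have e1 := Nat.div_mul_cancel (Nat.gcd_dvd_right m l)
    have e2 := Nat.div_mul_cancel (Nat.gcd_dvd_left m l)
    have e3 := Nat.div_mul_cancel (Nat.gcd_dvd_right m' l')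
    have e4 := Nat.div_mul_cancel (Nat.gcd_dvd_left m' l')
    rw [Prod.mk.injEq]
    exact ⟨by rw [← e1, ← e3, h2, h1], by rw [← e2, ← e4, h3, h1]⟩
  rw [hR, ← sum_product' s s fun l m : ℕ => √(Nat.gcd m l : ℝ) / (l * m)]
  calc ∑ p ∈ s ×ˢ s, √(Nat.gcd p.2 p.1 : ℝ) / (p.1 * p.2)
      ≤ ∑ p ∈ s ×ˢ s, G (φ p) := by
        refine sum_le_sum fun p hp => ?_
        obtain ⟨l, m⟩ := p
        simp only [hs, mem_product, mem_Icc] at hp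
        simp only [hG, hφ]
        have hl : (0 : ℝ) < l := Nat.cast_pos.2 hp.1.1
        have hm : (0 : ℝ) < m := Nat.cast_pos.2 hp.2.1
        have hg : 0 < Nat.gcd m l := Nat.gcd_pos_of_pos_left _ hp.2.1
        have hg' : (1 : ℝ) ≤ Nat.gcd m l := Nat.one_le_cast.2 hg
        have hg0 : (Nat.gcd m l : ℝ) ≠ 0 := by positivity
        rw [Nat.cast_div (Nat.gcd_dvd_right m l) hg0, Nat.cast_div (Nat.gcd_dvd_left m l) hg0]
        have e1 : 1 / (Nat.gcd m l : ℝ) * (1 / (l / (Nat.gcd m l : ℝ)) *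
            (1 / (m / (Nat.gcd m l : ℝ)))) = (Nat.gcd m l : ℝ) / (l * m) := by
          field_simp
        rw [e1]
        gcongr
        rw [Real.sqrt_le_left (by positivity)]
        nlinarith
    _ = ∑ p ∈ (s ×ˢ s).image φ, G p := (sum_image hinj).symm
    _ ≤ ∑ p ∈ s ×ˢ s ×ˢ s, G p := by
        refine sum_le_sum_of_subset_of_nonneg ?_ fun p _ _ => by positivity
        intro p hp
        obtain ⟨⟨l, m⟩, hlm, rfl⟩ := mem_image.1 hp
        simp only [hs, mem_product, mem_Icc] at hlm
        have hg : 0 < Nat.gcd m l := Nat.gcd_pos_of_pos_left _ hlm.2.1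
        have hgl := Nat.le_of_dvd hlm.1.1 (Nat.gcd_dvd_right m l)
        have hgm := Nat.le_of_dvd hlm.2.1 (Nat.gcd_dvd_left m l)
        simp only [hφ, hs, mem_product, mem_Icc]
        exact ⟨⟨hg, hgl.trans hlm.1.2⟩, ⟨Nat.div_pos hgl hg, (Nat.div_le_self _ _).trans hlm.1.2⟩,
          ⟨Nat.div_pos hgm hg, (Nat.div_le_self _ _).trans hlm.2.2⟩⟩

theorem sum_natAbs_le {s : Finset ℤ} {U : ℕ} (hs : ∀ ξ ∈ s, ξ.natAbs ∈ Icc 1 U) {h : ℕ → ℝ}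
    (hh : ∀ m, 0 ≤ h m) : ∑ ξ ∈ s, h ξ.natAbs ≤ 2 * ∑ m ∈ Icc 1 U, h m := by
  rw [← sum_fiberwise_of_maps_to hs, mul_sum]
  refine sum_le_sum fun m _ => ?_
  have hcard : #{ξ ∈ s | ξ.natAbs = m} ≤ 2 := by
    refine (card_le_card (t := {(m : ℤ), -(m : ℤ)}) fun ξ hξ => ?_).trans card_le_two
    rw [mem_filter] at hξ
    rw [mem_insert, mem_singleton]
    omega
  calc ∑ ξ ∈ s with ξ.natAbs = m, h ξ.natAbs = ∑ ξ ∈ s with ξ.natAbs = m, h m :=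
        sum_congr rfl fun ξ hξ => by rw [(mem_filter.1 hξ).2]
    _ = #{ξ ∈ s | ξ.natAbs = m} * h m := by rw [sum_const, nsmul_eq_mul]
    _ ≤ 2 * h m := by
        refine mul_le_mul_of_nonneg_right ?_ (hh m)
        exact_mod_cast hcard

theorem exists_harmonic_sum_le {δ : ℝ} (hδ : 0 < δ) {c : ℝ} (hc : 0 < c) :
    ∃ Z : ℝ, 0 ≤ Z ∧ ∀ X : ℝ, 1 ≤ X → ∑ d ∈ Icc 1 ⌊c * X⌋₊, (1 : ℝ) / d ≤ Z * X ^ δ := by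
  refine ⟨1 + c ^ δ / δ, by positivity, fun X hX => ?_⟩
  have hX0 : 0 ≤ X := by linarith
  have h1 : ∑ d ∈ Icc 1 ⌊c * X⌋₊, (1 : ℝ) / d = (harmonic ⌊c * X⌋₊ : ℝ) := by
    rw [harmonic_eq_sum_Icc]
    push_cast
    simp only [one_div]
  have h2 : Real.log ⌊c * X⌋₊ ≤ c ^ δ / δ * X ^ δ := by
    refine (Real.log_le_rpow_div (Nat.cast_nonneg _) hδ).trans ?_
    rw [div_mul_eq_mul_div, ← Real.mul_rpow hc.le hX0]
    gcongr
    exact Nat.floor_le (by positivity)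
  rw [h1]
  refine (harmonic_le_one_add_log _).trans ?_
  rw [add_mul, one_mul]
  exact add_le_add (Real.one_le_rpow hX hδ.le) h2

theorem gcd_two_mul_le (l f : ℕ) (hl : 0 < l) (hf : 0 < f) (ξ : ℤ) :
    (Int.gcd (2 * ξ) (4 * l * f ^ 2 : ℕ) : ℝ) ≤ 4 * f ^ 2 * Nat.gcd ξ.natAbs l := by
  have h1 : Int.gcd (2 * ξ) (4 * l * f ^ 2 : ℕ) ∣ 4 * f ^ 2 * Nat.gcd ξ.natAbs l := by
    rw [← Nat.gcd_mul_left]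
    refine Nat.dvd_gcd ?_ ?_
    · refine (Nat.gcd_dvd_left _ _).trans ⟨2 * f ^ 2, ?_⟩
      rw [Int.natAbs_mul]
      simp only [Int.reduceAbs]
      ring
    · refine (Nat.gcd_dvd_right _ _).trans ⟨1, ?_⟩
      rw [Int.natAbs_natCast]
      ring
  have h2 := Nat.le_of_dvd (by have := Nat.gcd_pos_of_pos_right ξ.natAbs hl; positivity) h1
  exact_mod_cast h2

end BeyondEndoscopy

/-! ### Assembly of the bound for `S`. -/

namespace BeyondEndoscopy

open scoped Real
open Finset

/-- In the range of summation, `4 l f ^ 2 ∣ 2 ξ` forces `X` to be bounded. -/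
theorem exists_forall_dvd_le {κ α c₁ c₄ : ℝ} (hκα : 2 * κ + α < 1 / 12) (hc₁ : 0 < c₁)
    (hc₄ : 0 < c₄) :
    ∃ X₀ : ℝ, 0 ≤ X₀ ∧ ∀ (X : ℝ) (l f : ℕ) (ξ : ℤ), 0 < X → ξ ≠ 0 →
      c₁ * X ^ (1 / 4 - κ) ≤ (l : ℝ) * f ^ 2 → |(ξ : ℝ)| ≤ c₄ * X ^ (1 / 6 + κ + α) →
      ((4 * l * f ^ 2 : ℕ) : ℤ) ∣ 2 * ξ → X ≤ X₀ := by
  -- The gap between the exponents `1 / 4 - κ` and `1 / 6 + κ + α`.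
  set δ : ℝ := 1 / 12 - 2 * κ - α with hδ
  have hδ0 : 0 < δ := by linarith
  refine ⟨(c₄ / c₁) ^ δ⁻¹, by positivity, fun X l f ξ hX hξ hl hξ' hdvd => ?_⟩
  have h1 : ((4 * l * f ^ 2 : ℕ) : ℤ) ≤ |2 * ξ| :=
    Int.le_of_dvd (abs_pos.2 (by omega)) ((dvd_abs _ _).2 hdvd)
  have h2 : 4 * ((l : ℝ) * f ^ 2) ≤ 2 * |(ξ : ℝ)| := by
    have : ((4 * l * f ^ 2 : ℕ) : ℝ) ≤ |2 * (ξ : ℝ)| := by exact_mod_cast h1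
    rw [abs_mul, abs_of_pos (two_pos : (0 : ℝ) < 2)] at this
    push_cast at this
    linarith
  have h3 : c₁ * X ^ (1 / 4 - κ) ≤ c₄ * X ^ (1 / 6 + κ + α) := by
    have : 0 ≤ (l : ℝ) * f ^ 2 := by positivity
    linarith
  have h4 : X ^ δ ≤ c₄ / c₁ := by
    rw [le_div_iff₀ hc₁]
    have hpow : X ^ (1 / 4 - κ) = X ^ δ * X ^ (1 / 6 + κ + α) := by
      rw [← Real.rpow_add hX]
      congr 1
      rw [hδ]
      ring
    have hp : 0 < X ^ (1 / 6 + κ + α) := Real.rpow_pos_of_pos hX _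
    rw [hpow, ← mul_assoc] at h3
    have := le_of_mul_le_mul_right h3 hp
    linarith
  calc X = (X ^ δ) ^ δ⁻¹ := by rw [← Real.rpow_mul hX.le, mul_inv_cancel₀ hδ0.ne', Real.rpow_one]
    _ ≤ (c₄ / c₁) ^ δ⁻¹ := by gcongr

/-- Both range conditions on `ξ` enter through `√l f m = √(l f ^ 2 m) √m`. What is left over is a
summand of harmonic type. -/
theorem term_weight_le {l f m g : ℕ} {Y Z : ℝ} (hl : 0 < l) (hf : 0 < f) (hm : 0 < m)
    (hY : (l : ℝ) * f ^ 2 * m ≤ Y) (hZ : (m : ℝ) ≤ Z) :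
    1 / ((l : ℝ) ^ 2 * f ^ 3) * (4 * (l * f ^ 2) * √(l * (4 * f ^ 2 * g))) ≤
      8 * (√Y * √Z) * (1 / f * (√g / (l * m))) := by
  have hl' : (0 : ℝ) < l := Nat.cast_pos.2 hl
  have hf' : (0 : ℝ) < f := Nat.cast_pos.2 hf
  have hm' : (0 : ℝ) < m := Nat.cast_pos.2 hm
  have e1 : √((l : ℝ) * (4 * f ^ 2 * g)) = √l * (2 * f * √g) := by
    rw [Real.sqrt_mul hl'.le, Real.sqrt_mul (by positivity), show (4 : ℝ) * f ^ 2 = (2 * f) ^ 2 by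
      ring, Real.sqrt_sq (by positivity)]
  have hsl : 0 < √(l : ℝ) := Real.sqrt_pos.2 hl'
  have hsl2 : √(l : ℝ) * √l = l := Real.mul_self_sqrt hl'.le
  have h2 : √(l : ℝ) * f * m ≤ √Y * √Z := by
    calc √(l : ℝ) * f * m = √(l * f ^ 2 * m) * √m := by
          rw [Real.sqrt_mul (by positivity), Real.sqrt_mul hl'.le, Real.sqrt_sq hf'.le, mul_assoc _ √_,
            Real.mul_self_sqrt hm'.le]
      _ ≤ √Y * √Z := by gcongr
  calc 1 / ((l : ℝ) ^ 2 * f ^ 3) * (4 * (l * f ^ 2) * √(l * (4 * f ^ 2 * g)))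
      = 8 * (√(l : ℝ) * f * m) * (1 / f * (√g / (l * m))) := by
        rw [e1]
        field_simp
        ring
    _ ≤ 8 * (√Y * √Z) * (1 / f * (√g / (l * m))) := by gcongr

theorem S_eq_sum (k : ℕ) (c₁ c₂ c₃ c₄ X κ α : ℝ) :
    S k c₁ c₂ c₃ c₄ X κ α =
      ∑ p ∈ critPairs c₁ c₂ X κ, ∑ ξ ∈ critFreqs c₃ c₄ X κ α p.1 p.2,
        1 / ((p.1 : ℂ) ^ 2 * (p.2 : ℂ) ^ 3) * ∑ i ∈ range (⌈X⌉₊ - 1),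
          (√((i : ℝ) + 1) : ℂ) * (Kl p.1 p.2 ξ (i + 1) * I k p.1 p.2 ξ (i + 1)) := by
  rw [S, sum_Ico_eq_sum_range]
  simp_rw [mul_sum]
  rw [sum_comm]
  refine sum_congr rfl fun p _ => ?_
  rw [sum_comm]
  refine sum_congr rfl fun ξ _ => sum_congr rfl fun i _ => ?_
  rw [add_comm 1 i]
  push_cast
  ring

theorem norm_S_le (k : ℕ) {κ α c₁ c₂ c₃ c₄ : ℝ} (hκ : 0 < κ) (hα : 0 < α)
    (hκα : 2 * κ + α < 1 / 12) (hc₁ : 0 < c₁) (hc₂ : 0 < c₂) (hc₄ : 0 < c₄) :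
    ∃ C : ℝ, 0 ≤ C ∧ ∀ X : ℝ, 1 ≤ X →
      ‖S k c₁ c₂ c₃ c₄ X κ α‖ ≤ C * √X *
        (√(c₃ * X ^ (1 / 2 + κ)) * √(c₄ * X ^ (1 / 6 + κ + α))) *
          (∑ d ∈ Icc 1 ⌊(c₂ + c₄) * X⌋₊, (1 : ℝ) / d) ^ 4 := by
  obtain ⟨C, hC0, hC⟩ := exists_norm_sum_sqrt_mul_Kl_mul_I_le k
  obtain ⟨X₀, hX₀, hdvd⟩ := exists_forall_dvd_le hκα hc₁ hc₄
  -- `1 + X₀` pays for the frequencies with `q ∣ 2 ξ`; `16` is the `8` of `term_weight_le` times `2`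
  -- for the sign of `ξ`.
  refine ⟨C * (1 + X₀) * 16, by positivity, fun X hX => ?_⟩
  have hX0 : 0 < X := by linarith
  set Y := c₃ * X ^ (1 / 2 + κ) with hYdef
  set Z := c₄ * X ^ (1 / 6 + κ + α) with hZdef
  set U := ⌊(c₂ + c₄) * X⌋₊ with hU
  set m := ⌈X⌉₊ - 1 with hm
  have hmX : (m : ℝ) ≤ X := by
    have h1 : ⌈X⌉₊ < X + 1 := Nat.ceil_lt_add_one hX0.le
    have h2 : 1 ≤ ⌈X⌉₊ := Nat.one_le_ceil_iff.2 hX0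
    rw [hm, Nat.cast_sub h2]
    push_cast
    linarith
  have hle2 : c₂ * X ^ (1 / 2 + κ) ≤ (c₂ + c₄) * X := by
    have : X ^ (1 / 2 + κ) ≤ X := by
      conv_rhs => rw [← Real.rpow_one X]
      exact Real.rpow_le_rpow_of_exponent_le hX (by linarith)
    calc c₂ * X ^ (1 / 2 + κ) ≤ c₂ * X := by gcongr
      _ ≤ (c₂ + c₄) * X := by gcongr; linarith
  have hle4 : Z ≤ (c₂ + c₄) * X := by
    have : X ^ (1 / 6 + κ + α) ≤ X := by
      conv_rhs => rw [← Real.rpow_one X]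
      exact Real.rpow_le_rpow_of_exponent_le hX (by linarith)
    calc Z ≤ c₄ * X := by rw [hZdef]; gcongr
      _ ≤ (c₂ + c₄) * X := by gcongr; linarith
  have hpairs : critPairs c₁ c₂ X κ ⊆ Icc 1 U ×ˢ Icc 1 U := by
    rintro ⟨l, f⟩ hp
    rw [mem_critPairs] at hp
    obtain ⟨hl, hf, -, hlf⟩ := hp
    have hl' : (1 : ℝ) ≤ l := Nat.one_le_cast.2 hl
    have hf' : (1 : ℝ) ≤ f := Nat.one_le_cast.2 hf
    rw [mem_product, mem_Icc, mem_Icc]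
    refine ⟨⟨hl, Nat.le_floor ?_⟩, ⟨hf, Nat.le_floor ?_⟩⟩
    · refine le_trans ?_ (hlf.trans hle2)
      exact le_mul_of_one_le_right (by linarith) (one_le_pow₀ hf')
    · refine le_trans ?_ (hlf.trans hle2)
      nlinarith [mul_nonneg (sub_nonneg.2 hl') (sq_nonneg (f : ℝ))]
  set h : ℕ → ℕ → ℕ → ℝ := fun l f j => 1 / (f : ℝ) * (√(Nat.gcd j l : ℝ) / (l * j)) with hh
  set R : ℝ := C * (1 + X₀) * √X * (8 * (√Y * √Z)) with hR
  have hR0 : 0 ≤ R := by positivity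
  have hterm : ∀ p ∈ critPairs c₁ c₂ X κ, ∀ ξ ∈ critFreqs c₃ c₄ X κ α p.1 p.2,
      ‖1 / ((p.1 : ℂ) ^ 2 * (p.2 : ℂ) ^ 3) * ∑ i ∈ range m,
          (√((i : ℝ) + 1) : ℂ) * (Kl p.1 p.2 ξ (i + 1) * I k p.1 p.2 ξ (i + 1))‖ ≤
        R * h p.1 p.2 ξ.natAbs := by
    rintro ⟨l, f⟩ hp ξ hξ
    rw [mem_critPairs] at hp
    rw [mem_critFreqs] at hξ
    obtain ⟨hl, hf, hlf, -⟩ := hp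
    obtain ⟨hξ0, hξY, hξZ⟩ := hξ
    have hmabs : ((ξ.natAbs : ℕ) : ℝ) = |(ξ : ℝ)| := Nat.cast_natAbs ξ |>.trans (Int.cast_abs)
    have hξpos : 0 < ξ.natAbs := Int.natAbs_pos.2 hξ0
    simp only at hξY ⊢
    set q := 4 * (l * f ^ 2 : ℝ) * √(l * Int.gcd (2 * ξ) (4 * l * f ^ 2 : ℕ)) with hq
    have hpartial : ∀ j ≤ m, ‖∑ i ∈ range j, Kl l f ξ (i + 1)‖ ≤ (1 + X₀) * q := by
      intro j hj
      have hjX : (j : ℝ) ≤ X := le_trans (Nat.cast_le.2 hj) hmX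
      -- In the exceptional case `A = 1`, and the length is at most `X ≤ X₀`. Otherwise `A = 0` and
      -- the length does not matter.
      by_cases hd : ((4 * l * f ^ 2 : ℕ) : ℤ) ∣ 2 * ξ
      · refine (norm_sum_Kl_le hl hf ξ zero_le_one (fun _ => le_rfl) j).trans ?_
        have := hdvd X l f ξ hX0 hξ0 hlf hξZ hd
        gcongr
        linarith
      · refine (norm_sum_Kl_le hl hf ξ le_rfl (fun h => absurd h hd) j).trans ?_
        gcongr
        linarith
    have hsum := hC l f ξ m _ hl hf hpartial
    have hqle : q ≤ 4 * (l * f ^ 2) * √(l * (4 * f ^ 2 * (Nat.gcd ξ.natAbs l : ℕ))) := by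
      rw [hq]
      gcongr
      exact gcd_two_mul_le l f hl hf ξ
    have hw := term_weight_le (g := Nat.gcd ξ.natAbs l) (Y := Y) (Z := Z) hl hf hξpos
      (by rw [hmabs]; exact hξY) (by rw [hmabs]; exact hξZ)
    rw [norm_mul]
    have hnorm : ‖1 / ((l : ℂ) ^ 2 * (f : ℂ) ^ 3)‖ = 1 / ((l : ℝ) ^ 2 * f ^ 3) := by
      simp
    rw [hnorm]
    calc 1 / ((l : ℝ) ^ 2 * f ^ 3) * ‖∑ i ∈ range m,
          (√((i : ℝ) + 1) : ℂ) * (Kl l f ξ (i + 1) * I k l f ξ (i + 1))‖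
        ≤ 1 / ((l : ℝ) ^ 2 * f ^ 3) * (C * ((1 + X₀) *
          (4 * (l * f ^ 2) * √(l * (4 * f ^ 2 * (Nat.gcd ξ.natAbs l : ℕ))))) * √X) := by
          gcongr
          refine hsum.trans ?_
          gcongr
      _ = C * (1 + X₀) * √X * (1 / ((l : ℝ) ^ 2 * f ^ 3) *
          (4 * (l * f ^ 2) * √(l * (4 * f ^ 2 * (Nat.gcd ξ.natAbs l : ℕ))))) := by ring
      _ ≤ C * (1 + X₀) * √X * (8 * (√Y * √Z) *
          (1 / f * (√(Nat.gcd ξ.natAbs l : ℕ) / (l * ξ.natAbs)))) := by gcongr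
      _ = R * h l f ξ.natAbs := by simp only [hR, hh]; ring
  have hfreq : ∀ p : ℕ × ℕ, ∀ ξ ∈ critFreqs c₃ c₄ X κ α p.1 p.2, ξ.natAbs ∈ Icc 1 U := by
    intro p ξ hξ
    rw [mem_critFreqs] at hξ
    rw [mem_Icc]
    refine ⟨Int.natAbs_pos.2 hξ.1, Nat.le_floor ?_⟩
    rw [Nat.cast_natAbs, Int.cast_abs]
    exact hξ.2.2.trans hle4
  have hh0 : ∀ l f j, 0 ≤ h l f j := fun l f j => by positivity
  rw [S_eq_sum]
  calc ‖∑ p ∈ critPairs c₁ c₂ X κ, ∑ ξ ∈ critFreqs c₃ c₄ X κ α p.1 p.2,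
        1 / ((p.1 : ℂ) ^ 2 * (p.2 : ℂ) ^ 3) * ∑ i ∈ range m,
          (√((i : ℝ) + 1) : ℂ) * (Kl p.1 p.2 ξ (i + 1) * I k p.1 p.2 ξ (i + 1))‖
      ≤ ∑ p ∈ critPairs c₁ c₂ X κ, ∑ ξ ∈ critFreqs c₃ c₄ X κ α p.1 p.2,
          R * h p.1 p.2 ξ.natAbs :=
        norm_sum_le_of_le _ fun p hp => norm_sum_le_of_le _ fun ξ hξ => hterm p hp ξ hξ
    _ ≤ ∑ p ∈ critPairs c₁ c₂ X κ, R * (2 * ∑ j ∈ Icc 1 U, h p.1 p.2 j) := by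
        refine sum_le_sum fun p _ => ?_
        rw [← mul_sum]
        gcongr
        exact sum_natAbs_le (hfreq p) (hh0 _ _)
    _ ≤ ∑ p ∈ Icc 1 U ×ˢ Icc 1 U, R * (2 * ∑ j ∈ Icc 1 U, h p.1 p.2 j) := by
        refine sum_le_sum_of_subset_of_nonneg hpairs fun p _ _ => ?_
        have := sum_nonneg fun j (_ : j ∈ Icc 1 U) => hh0 p.1 p.2 j
        positivity
    _ = R * 2 * ((∑ f ∈ Icc 1 U, (1 : ℝ) / f) *
          ∑ l ∈ Icc 1 U, ∑ j ∈ Icc 1 U, √(Nat.gcd j l : ℝ) / (l * j)) := by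
        rw [sum_product_right, sum_mul, mul_sum]
        refine sum_congr rfl fun f _ => ?_
        rw [mul_sum, mul_sum]
        refine sum_congr rfl fun l _ => ?_
        rw [mul_sum, mul_sum, mul_sum, mul_sum]
        refine sum_congr rfl fun j _ => ?_
        simp only [hh]
        ring
    _ ≤ R * 2 * ((∑ f ∈ Icc 1 U, (1 : ℝ) / f) * (∑ d ∈ Icc 1 U, (1 : ℝ) / d) ^ 3) := by
        gcongr
        exact sum_sqrt_gcd_div_le U
    _ = C * (1 + X₀) * 16 * √X * (√Y * √Z) * (∑ d ∈ Icc 1 U, (1 : ℝ) / d) ^ 4 := by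
        rw [hR]
        ring

end BeyondEndoscopy

theorem corollary4p10 (k : ℕ) (hk : 3 ≤ k) (κ α : ℝ) (hκ : 0 < κ) (hα : 0 < α)
    (hκα : 2 * κ + α < 1 / 12) (ε : ℝ) (hε : 0 < ε)
    (c₁ c₂ c₃ c₄ : ℝ) (hc₁ : 0 < c₁) (hc₂ : 0 < c₂) (hc₃ : 0 < c₃) (hc₄ : 0 < c₄) :
    ∃ K : ℝ, ∀ X : ℝ, 0 < X →
      ‖BeyondEndoscopy.S k c₁ c₂ c₃ c₄ X κ α‖ ≤
        K * X ^ (11 / 12 + κ + α + 11 * ε / 6) := by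
  obtain ⟨C, hC0, hC⟩ :=
    BeyondEndoscopy.norm_S_le k (c₃ := c₃) hκ hα hκα hc₁ hc₂ hc₄
  -- Four harmonic sums at `1 / 48` cost `X ^ (1 / 12)`, exactly the difference between `5 / 6` and
  -- `11 / 12`.
  obtain ⟨Z, hZ0, hZ⟩ := BeyondEndoscopy.exists_harmonic_sum_le
    (show (0 : ℝ) < 1 / 48 by norm_num) (add_pos hc₂ hc₄)
  refine ⟨C * (√c₃ * √c₄) * Z ^ 4, fun X hX => ?_⟩
  rcases lt_or_ge X 1 with hX1 | hX1
  -- For `X < 1` no `n` occurs and the sum is empty.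
  · have hceil : ⌈X⌉₊ - 1 = 0 := Nat.sub_eq_zero_of_le (Nat.ceil_le.2 (by simpa using hX1.le))
    rw [BeyondEndoscopy.S_eq_sum, hceil]
    simp only [Finset.range_zero, Finset.sum_empty, mul_zero, Finset.sum_const_zero, norm_zero]
    positivity
  · have hpow : X ^ (1 / 2 : ℝ) * (X ^ ((1 / 2 + κ) / 2) * X ^ ((1 / 6 + κ + α) / 2)) *
        X ^ (1 / 48 * 4 : ℝ) ≤ X ^ (11 / 12 + κ + α + 11 * ε / 6) := by
      rw [← Real.rpow_add hX, ← Real.rpow_add hX, ← Real.rpow_add hX]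
      exact Real.rpow_le_rpow_of_exponent_le hX1 (by linarith)
    have hsqrt : ∀ {c : ℝ} (_ : 0 ≤ c) (a : ℝ), √(c * X ^ a) = √c * X ^ (a / 2) := by
      intro c hc a
      rw [Real.sqrt_mul hc, Real.sqrt_eq_rpow (X ^ a), ← Real.rpow_mul hX.le]
      congr 2
      ring
    refine (hC X hX1).trans ?_
    rw [hsqrt hc₃.le, hsqrt hc₄.le, Real.sqrt_eq_rpow X]
    calc C * X ^ (1 / 2 : ℝ) *
          (√c₃ * X ^ ((1 / 2 + κ) / 2) * (√c₄ * X ^ ((1 / 6 + κ + α) / 2))) *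
          (∑ d ∈ Finset.Icc 1 ⌊(c₂ + c₄) * X⌋₊, (1 : ℝ) / d) ^ 4
        ≤ C * X ^ (1 / 2 : ℝ) *
          (√c₃ * X ^ ((1 / 2 + κ) / 2) * (√c₄ * X ^ ((1 / 6 + κ + α) / 2))) *
          (Z * X ^ (1 / 48 : ℝ)) ^ 4 := by
          gcongr
          exact hZ X hX1
      _ = C * (√c₃ * √c₄) * Z ^ 4 *
          (X ^ (1 / 2 : ℝ) * (X ^ ((1 / 2 + κ) / 2) * X ^ ((1 / 6 + κ + α) / 2)) *
          X ^ (1 / 48 * 4 : ℝ)) := by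
          rw [mul_pow, Real.rpow_mul hX.le (1 / 48) 4]
          norm_cast
          ring
      _ ≤ C * (√c₃ * √c₄) * Z ^ 4 * X ^ (11 / 12 + κ + α + 11 * ε / 6) := by gcongr
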